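/- Let $G$ be a locally compact (Hausdorff) group with identity $e$ and left Haar measure $dx$, let $1<p<\infty$ and $\frac1p+\frac1q=1$. Let $A_p(G)$ be the space of all functions in $C_0(G)$ of the form $u=\sum_{i=1}^\infty g_i*f_i^\vee$ (pointwise) with $f_i\in L^p(G)$, $g_i\in L^q(G)$, $\sum_i\|f_i\|_p\|g_i\|_q<\infty$, where $f^\vee(x)=f(x^{-1})$ and $(g*h)(x)=\int_G g(y)h(y^{-1}x)\,dy$, with the norm $$\|u\|_{A_p(G)}=\inf\Big\{\sum_{i}\|f_i\|_p\|g_i\|_q:\ u=\sum_{i} g_i*f_i^\vee\Big\}.$$ Let $B_p(G)$ be the algebra of all bounded continuous functions $u:G\to\mathbb C$ with $uv\in A_p(G)$ for all $v\in A_p(G)$, with the norm $\|u\|=\sup\{\|uv\|_{A_p(G)}:\ v\in A_p(G),\ \|v\|_{A_p(G)}\le 1\}$. Let $I\in B_p(G)^*$ be the functional $I(u)=u(e)$. For $\phi\in B_p(G)^*$, $F\in B_p(G)^{**}$ and $u\in B_p(G)$ define $\phi u\in B_p(G)^*$ by $\langle\phi u,v\rangle=\langle\phi,uv\rangle$ for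 $v\in B_p(G)$, and $uF\in B_p(G)^{**}$ by $\langle uF,\phi\rangle=\langle F,\phi u\rangle$ for $\phi\in B_p(G)^*$. Then there is $F\in B_p(G)^{**}$ with $\|F\|=F(I)=1$ and $uF=u(e)F$ for all $u\in B_p(G)$. -/

import Mathlib

open MeasureTheory Filter Topology
open scoped ENNReal BoundedContinuousFunction ZeroAtInfty

noncomputable section

namespace Herz

theorem lpNorm_nonneg' {X : Type*} [MeasurableSpace X] {r : ℝ≥0∞} {μ : Measure X} (f : Lp ℂ r μ) : 0 ≤ ‖f‖ := by
  rw [Lp.norm_def]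
  exact ENNReal.toReal_nonneg

theorem lpNorm_smul' {X : Type*} [MeasurableSpace X] {r : ℝ≥0∞} {μ : Measure X} (c : ℂ) (f : Lp ℂ r μ) :
    ‖c • f‖ = ‖c‖ * ‖f‖ := by
  rw [Lp.norm_def, Lp.norm_def, eLpNorm_congr_ae (Lp.coeFn_smul c f), eLpNorm_const_smul,
    ENNReal.toReal_mul, toReal_enorm]

section Basic

variable {G : Type*} [Group G] [MeasurableSpace G]

/-- The function `x ↦ f (x⁻¹)`. -/
def check (f : G → ℂ) : G → ℂ := fun x => f x⁻¹

/-- Convolution `(g * h)(x) = ∫ g(y) h(y⁻¹x) dμ(y)` with respect to a (left Haar) measure `μ`. -/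
def conv (μ : Measure G) (g h : G → ℂ) : G → ℂ := fun x => ∫ y, g y * h (y⁻¹ * x) ∂μ

/-- `u = ∑ᵢ gᵢ * fᵢ^∨` pointwise, with `fᵢ ∈ L^p`, `gᵢ ∈ L^q` and `∑ᵢ ‖fᵢ‖_p ‖gᵢ‖_q < ∞`. -/
structure IsRep (p q : ℝ≥0∞) (μ : Measure G) (u : G → ℂ)
    (f : ℕ → Lp ℂ p μ) (g : ℕ → Lp ℂ q μ) : Prop where
  summable : Summable fun i => ‖f i‖ * ‖g i‖
  hasSum : ∀ x, HasSum (fun i => conv μ (g i) (check (f i)) x) (u x)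

/-- The numbers `∑ᵢ ‖fᵢ‖_p ‖gᵢ‖_q` over all representations `u = ∑ᵢ gᵢ * fᵢ^∨`. -/
def repSums (p q : ℝ≥0∞) (μ : Measure G) (u : G → ℂ) : Set ℝ :=
  {r | ∃ (f : ℕ → Lp ℂ p μ) (g : ℕ → Lp ℂ q μ), IsRep p q μ u f g ∧ r = ∑' i, ‖f i‖ * ‖g i‖}

theorem conv_check (μ : Measure G) (g f : G → ℂ) (x : G) :
    conv μ g (check f) x = ∫ y, g y * f (x⁻¹ * y) ∂μ := by
  simp [conv, check]

theorem repSums_nonneg {p q : ℝ≥0∞} {μ : Measure G} {u : G → ℂ} {r : ℝ}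
    (hr : r ∈ repSums p q μ u) : 0 ≤ r := by
  obtain ⟨f, g, -, rfl⟩ := hr
  exact tsum_nonneg fun i => mul_nonneg (lpNorm_nonneg' _) (lpNorm_nonneg' _)

theorem repSums_bddBelow (p q : ℝ≥0∞) (μ : Measure G) (u : G → ℂ) :
    BddBelow (repSums p q μ u) := ⟨0, fun _ hr => repSums_nonneg hr⟩

theorem repSums_zero (p q : ℝ≥0∞) (μ : Measure G) : (0 : ℝ) ∈ repSums p q μ (0 : G → ℂ) := by
  refine ⟨0, 0, ⟨?_, fun x => ?_⟩, ?_⟩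
  · simp
  · have : (fun i : ℕ => conv μ ((0 : ℕ → Lp ℂ q μ) i) (check ((0 : ℕ → Lp ℂ p μ) i)) x)
        = fun _ => 0 := by
      funext i
      rw [conv_check]
      rw [integral_eq_zero_of_ae]
      filter_upwards [Lp.coeFn_zero ℂ q μ] with y hy
      simp only [Pi.zero_apply] at hy ⊢
      rw [hy, zero_mul]
    rw [this]
    exact hasSum_zero
  · simp

theorem repSums_smul {p q : ℝ≥0∞} {μ : Measure G} {u : G → ℂ} (c : ℂ) {r : ℝ}
    (hr : r ∈ repSums p q μ u) : ‖c‖ * r ∈ repSums p q μ (c • u) := by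
  obtain ⟨f, g, h, rfl⟩ := hr
  have hn : ∀ i, ‖f i‖ * ‖c • g i‖ = ‖c‖ * (‖f i‖ * ‖g i‖) := fun i => by
    rw [lpNorm_smul']; ring
  refine ⟨f, fun i => c • g i, ⟨?_, fun x => ?_⟩, ?_⟩
  · simp only [hn]
    exact h.summable.mul_left _
  · have : (fun i => conv μ (c • g i : Lp ℂ q μ) (check (f i)) x)
        = fun i => c * conv μ (g i) (check (f i)) x := by
      funext i
      rw [conv_check, conv_check, ← integral_const_mul]
      refine integral_congr_ae ?_
      filter_upwards [Lp.coeFn_smul c (g i)] with y hy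
      rw [hy, Pi.smul_apply, smul_eq_mul, mul_assoc]
    rw [this]
    exact (h.hasSum x).mul_left c
  · simp only [hn]
    rw [tsum_mul_left]

end Basic

section Topological

variable {G : Type*} [Group G] [TopologicalSpace G] [IsTopologicalGroup G]
  [MeasurableSpace G] [BorelSpace G]

theorem norm_conv_check_le {p q : ℝ≥0∞} [p.HolderConjugate q] (μ : Measure G)
    [μ.IsMulLeftInvariant] (f : Lp ℂ p μ) (g : Lp ℂ q μ) (x : G) :
    ‖conv μ g (check f) x‖ ≤ ‖f‖ * ‖g‖ := by
  rw [conv_check]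
  have hmp : MeasurePreserving (fun y => x⁻¹ * y) μ μ := measurePreserving_mul_left μ x⁻¹
  have hf : MemLp (fun y => f (x⁻¹ * y)) p μ := (Lp.memLp f).comp_measurePreserving hmp
  have hfn : eLpNorm (fun y => f (x⁻¹ * y)) p μ = eLpNorm f p μ :=
    eLpNorm_comp_measurePreserving (Lp.memLp f).1 hmp
  have : q.HolderConjugate p := ENNReal.HolderTriple.symm
  have h1 : eLpNorm ((g : G → ℂ) • fun y => f (x⁻¹ * y)) 1 μ
      ≤ eLpNorm g q μ * eLpNorm f p μ := by
    rw [← hfn]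
    exact eLpNorm_smul_le_mul_eLpNorm hf.1 (Lp.memLp g).1
  have h2 : ‖∫ y, g y * f (x⁻¹ * y) ∂μ‖ₑ ≤ eLpNorm g q μ * eLpNorm f p μ := by
    refine (enorm_integral_le_lintegral_enorm _).trans ?_
    rwa [eLpNorm_one_eq_lintegral_enorm] at h1
  rw [Lp.norm_def, Lp.norm_def, ← ENNReal.toReal_mul, ← toReal_enorm, mul_comm]
  exact ENNReal.toReal_mono (ENNReal.mul_ne_top (Lp.eLpNorm_ne_top _) (Lp.eLpNorm_ne_top _)) h2

theorem norm_le_of_mem_repSums {p q : ℝ≥0∞} [p.HolderConjugate q] {μ : Measure G}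
    [μ.IsMulLeftInvariant] {u : G → ℂ} {r : ℝ} (hr : r ∈ repSums p q μ u) (x : G) :
    ‖u x‖ ≤ r := by
  obtain ⟨f, g, h, rfl⟩ := hr
  rw [← (h.hasSum x).tsum_eq]
  exact tsum_of_norm_bounded h.summable.hasSum fun i => norm_conv_check_le μ (f i) (g i) x

/-- Representations of countably many functions combine to one of their sum. -/
theorem repSums_tsum {p q : ℝ≥0∞} [p.HolderConjugate q] {μ : Measure G}
    [μ.IsMulLeftInvariant] {u : ℕ → G → ℂ} {r : ℕ → ℝ} (hr : ∀ n, r n ∈ repSums p q μ (u n))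
    (hs : Summable r) {v : G → ℂ} (hv : ∀ x, HasSum (fun n => u n x) (v x)) :
    ∑' n, r n ∈ repSums p q μ v := by
  choose f g h hrs using hr
  let e : ℕ ≃ ℕ × ℕ := Nat.pairEquiv.symm
  have hsum : Summable fun z : ℕ × ℕ => ‖f z.1 z.2‖ * ‖g z.1 z.2‖ := by
    rw [summable_prod_of_nonneg
      (fun z => mul_nonneg (lpNorm_nonneg' _) (lpNorm_nonneg' _))]
    refine ⟨fun n => (h n).summable, ?_⟩
    simpa only [← hrs] using hs
  refine ⟨fun k => f (e k).1 (e k).2, fun k => g (e k).1 (e k).2, ⟨?_, fun x => ?_⟩, ?_⟩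
  · exact (e.summable_iff (f := fun z : ℕ × ℕ => ‖f z.1 z.2‖ * ‖g z.1 z.2‖)).2 hsum
  · refine (e.hasSum_iff (f := fun z : ℕ × ℕ =>
      conv μ (g z.1 z.2) (check (f z.1 z.2)) x)).2 ?_
    have hc : Summable fun z : ℕ × ℕ => conv μ (g z.1 z.2) (check (f z.1 z.2)) x :=
      Summable.of_norm_bounded hsum fun z => norm_conv_check_le μ _ _ x
    have := hc.hasSum.prod_fiberwise fun n => (h n).hasSum x
    rw [(hv x).unique this]
    exact hc.hasSum
  · rw [e.tsum_eq (fun z : ℕ × ℕ => ‖f z.1 z.2‖ * ‖g z.1 z.2‖),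
      hsum.tsum_prod]
    exact tsum_congr hrs

theorem repSums_add {p q : ℝ≥0∞} [p.HolderConjugate q] {μ : Measure G}
    [μ.IsMulLeftInvariant] {u v : G → ℂ} {r s : ℝ} (hr : r ∈ repSums p q μ u)
    (hs : s ∈ repSums p q μ v) : r + s ∈ repSums p q μ (u + v) := by
  have key := repSums_tsum (μ := μ) (p := p) (q := q)
    (u := fun n => if n = 0 then u else if n = 1 then v else 0)
    (r := fun n => if n = 0 then r else if n = 1 then s else 0) (v := u + v) ?_ ?_ ?_
  · rw [tsum_eq_sum (s := Finset.range 2)] at key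
    · simpa [Finset.sum_range_succ] using key
    · intro n hn
      have : 2 ≤ n := by simpa [Nat.succ_le_iff] using hn
      simp [show n ≠ 0 by omega, show n ≠ 1 by omega]
  · intro n
    by_cases h0 : n = 0
    · simpa [h0] using hr
    · by_cases h1 : n = 1
      · simpa [h1] using hs
      · simpa [h0, h1] using repSums_zero p q μ
  · refine summable_of_ne_finset_zero (s := Finset.range 2) fun n hn => ?_
    have : 2 ≤ n := by simpa [Nat.succ_le_iff] using hn
    simp [show n ≠ 0 by omega, show n ≠ 1 by omega]
  · intro x
    have h2 : ∀ n ∉ Finset.range 2,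
        (if n = 0 then u else if n = 1 then v else 0 : G → ℂ) x = 0 := by
      intro n hn
      have : 2 ≤ n := by simpa [Nat.succ_le_iff] using hn
      simp [show n ≠ 0 by omega, show n ≠ 1 by omega]
    have := hasSum_sum_of_ne_finset_zero (L := .unconditional ℕ) h2
    simpa [Finset.sum_range_succ] using this

/-- `A_p(G)` as a linear space: the functions in `C₀(G)` of the form `∑ᵢ gᵢ * fᵢ^∨` with
`fᵢ ∈ L^p(G)`, `gᵢ ∈ L^q(G)` and `∑ᵢ ‖fᵢ‖_p ‖gᵢ‖_q < ∞`. -/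
def herzSubmodule (p q : ℝ≥0∞) [p.HolderConjugate q] (μ : Measure G) [μ.IsMulLeftInvariant] :
    Submodule ℂ (G → ℂ) where
  carrier := {u | (∃ c : C₀(G, ℂ), ⇑c = u) ∧
    ∃ (f : ℕ → Lp ℂ p μ) (g : ℕ → Lp ℂ q μ), IsRep p q μ u f g}
  zero_mem' := by
    obtain ⟨f, g, h, -⟩ := repSums_zero p q μ
    exact ⟨⟨0, rfl⟩, f, g, h⟩
  add_mem' := by
    rintro _ _ ⟨⟨c, rfl⟩, f, g, h⟩ ⟨⟨d, rfl⟩, f', g', h'⟩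
    obtain ⟨f'', g'', h'', -⟩ := repSums_add ⟨f, g, h, rfl⟩ ⟨f', g', h', rfl⟩
    exact ⟨⟨c + d, rfl⟩, f'', g'', h''⟩
  smul_mem' := by
    rintro a _ ⟨⟨c, rfl⟩, f, g, h⟩
    obtain ⟨f', g', h', -⟩ := repSums_smul a ⟨f, g, h, rfl⟩
    exact ⟨⟨a • c, rfl⟩, f', g', h'⟩

/-- The Herz algebra `A_p(G)`, where `1/p + 1/q = 1` and `μ` is a left Haar measure.
(It is a type of its own, so that it carries the `A_p`-norm and no other topology.) -/
def HerzAlgebra (p q : ℝ≥0∞) [p.HolderConjugate q] (μ : Measure G) [μ.IsMulLeftInvariant] :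
    Type _ := herzSubmodule p q μ

namespace HerzAlgebra

variable {p q : ℝ≥0∞} [p.HolderConjugate q] {μ : Measure G} [μ.IsMulLeftInvariant]

instance : AddCommGroup (HerzAlgebra p q μ) :=
  inferInstanceAs (AddCommGroup (herzSubmodule p q μ))

instance : Module ℂ (HerzAlgebra p q μ) :=
  inferInstanceAs (Module ℂ (herzSubmodule p q μ))

instance : CoeFun (HerzAlgebra p q μ) fun _ => G → ℂ := ⟨fun u => Subtype.val u⟩

@[ext] theorem ext {u v : HerzAlgebra p q μ} (h : ∀ x, u x = v x) : u = v :=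
  Subtype.ext (funext h)

theorem coe_add (u v : HerzAlgebra p q μ) (x : G) : (u + v) x = u x + v x := rfl
theorem coe_sub (u v : HerzAlgebra p q μ) (x : G) : (u - v) x = u x - v x := rfl
theorem coe_zero (x : G) : (0 : HerzAlgebra p q μ) x = 0 := rfl
theorem coe_smul (c : ℂ) (u : HerzAlgebra p q μ) (x : G) : (c • u) x = c * u x := rfl

/-- `‖u‖ = inf {∑ᵢ ‖fᵢ‖_p ‖gᵢ‖_q : u = ∑ᵢ gᵢ * fᵢ^∨}`. -/
instance : Norm (HerzAlgebra p q μ) := ⟨fun u => sInf (repSums p q μ u)⟩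

theorem norm_def (u : HerzAlgebra p q μ) : ‖u‖ = sInf (repSums p q μ u) := rfl

theorem repSums_nonempty (u : HerzAlgebra p q μ) : (repSums p q μ u).Nonempty := by
  obtain ⟨f, g, h⟩ := u.2.2
  exact ⟨_, f, g, h, rfl⟩

theorem norm_le {u : HerzAlgebra p q μ} {r : ℝ} (hr : r ∈ repSums p q μ u) : ‖u‖ ≤ r :=
  csInf_le (repSums_bddBelow p q μ u) hr

theorem exists_lt (u : HerzAlgebra p q μ) {ε : ℝ} (hε : 0 < ε) :
    ∃ r ∈ repSums p q μ u, r < ‖u‖ + ε :=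
  exists_lt_of_csInf_lt u.repSums_nonempty (lt_add_of_pos_right _ hε)

theorem norm_apply_le (u : HerzAlgebra p q μ) (x : G) : ‖u x‖ ≤ ‖u‖ :=
  le_csInf u.repSums_nonempty fun _ hr => norm_le_of_mem_repSums hr x

theorem norm_nonneg' (u : HerzAlgebra p q μ) : 0 ≤ ‖u‖ :=
  le_csInf u.repSums_nonempty fun _ hr => repSums_nonneg hr

theorem norm_smul_le' (c : ℂ) (u : HerzAlgebra p q μ) : ‖c • u‖ ≤ ‖c‖ * ‖u‖ := by
  refine le_of_forall_pos_le_add fun ε hε => ?_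
  obtain ⟨r, hr, hlt⟩ := u.exists_lt (ε := ε / (‖c‖ + 1)) (by positivity)
  have h1 : ‖c • u‖ ≤ ‖c‖ * r := norm_le (repSums_smul c hr)
  have h2 : ‖c‖ * r ≤ ‖c‖ * (‖u‖ + ε / (‖c‖ + 1)) :=
    mul_le_mul_of_nonneg_left hlt.le (norm_nonneg c)
  have h3 : ‖c‖ * (ε / (‖c‖ + 1)) ≤ ε := by
    rw [← mul_div_assoc, div_le_iff₀ (by positivity)]
    nlinarith [norm_nonneg c]
  linarith

theorem core : NormedSpace.Core ℂ (HerzAlgebra p q μ) where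
  norm_nonneg := norm_nonneg'
  norm_smul c u := by
    refine le_antisymm (norm_smul_le' c u) ?_
    by_cases hc : c = 0
    · simpa [hc] using norm_nonneg' _
    · have := norm_smul_le' c⁻¹ (c • u)
      rw [smul_smul, inv_mul_cancel₀ hc, one_smul, norm_inv] at this
      have hc' : 0 < ‖c‖ := norm_pos_iff.2 hc
      calc ‖c‖ * ‖u‖ ≤ ‖c‖ * (‖c‖⁻¹ * ‖c • u‖) := mul_le_mul_of_nonneg_left this hc'.le
        _ = ‖c • u‖ := by field_simp
  norm_triangle u v := by
    refine le_of_forall_pos_le_add fun ε hε => ?_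
    obtain ⟨r, hr, hr'⟩ := u.exists_lt (half_pos hε)
    obtain ⟨s, hs, hs'⟩ := v.exists_lt (half_pos hε)
    have : ‖u + v‖ ≤ r + s := norm_le (repSums_add hr hs)
    linarith
  norm_eq_zero_iff u := by
    constructor
    · intro h
      ext x
      have := norm_apply_le u x
      rw [h] at this
      exact norm_le_zero_iff.1 this
    · rintro rfl
      exact le_antisymm (norm_le (repSums_zero p q μ)) (norm_nonneg' _)

instance : NormedAddCommGroup (HerzAlgebra p q μ) := NormedAddCommGroup.ofCore core

instance : NormedSpace ℂ (HerzAlgebra p q μ) := NormedSpace.ofCore core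

/-- Evaluation at a point is bounded on `A_p(G)`. -/
def eval (x : G) : HerzAlgebra p q μ →L[ℂ] ℂ :=
  LinearMap.mkContinuous
    { toFun := fun u => u x, map_add' := fun _ _ => rfl, map_smul' := fun _ _ => rfl } 1
    fun u => by rw [one_mul]; exact norm_apply_le u x

/-- The inclusion of `A_p(G)` in `C₀(G)`. -/
def toC₀ (u : HerzAlgebra p q μ) : C₀(G, ℂ) := u.2.1.choose

theorem toC₀_apply (u : HerzAlgebra p q μ) (x : G) : u.toC₀ x = u x :=
  congrFun u.2.1.choose_spec x

theorem norm_toC₀_le (u : HerzAlgebra p q μ) : ‖u.toC₀‖ ≤ ‖u‖ := by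
  change ‖u.toC₀.toBCF‖ ≤ ‖u‖
  refine (BoundedContinuousFunction.norm_le (norm_nonneg u)).2 fun x => ?_
  have := norm_apply_le u x
  rwa [← toC₀_apply] at this

instance : CompleteSpace (HerzAlgebra p q μ) := by
  refine NormedAddCommGroup.completeSpace_of_summable_imp_tendsto fun u hu => ?_
  have hpos : ∀ n : ℕ, (0 : ℝ) < (1 / 2) ^ n := fun n => by positivity
  choose r hr hlt using fun n => (u n).exists_lt (hpos n)
  have hrs : Summable r := by
    refine Summable.of_nonneg_of_le (fun n => repSums_nonneg (hr n)) (fun n => (hlt n).le) ?_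
    exact hu.add (summable_geometric_of_lt_one (by norm_num) (by norm_num))
  have hC : Summable fun n => (u n).toC₀ :=
    Summable.of_norm_bounded hu fun n => norm_toC₀_le (u n)
  have hev : ∀ x : G, Continuous fun c : C₀(G, ℂ) => c x := fun x =>
    (BoundedContinuousFunction.lipschitz_eval_const x).continuous.comp
      (ZeroAtInftyContinuousMap.isometry_toBCF (α := G) (β := ℂ)).continuous
  have hpt : ∀ x, HasSum (fun n => u n x) ((∑' n, (u n).toC₀) x) := by
    intro x
    have := hC.hasSum.map
      (AddMonoidHom.mk' (fun c : C₀(G, ℂ) => c x) fun _ _ => rfl) (hev x)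
    simpa [Function.comp_def, toC₀_apply] using this
  have hmem : ∑' n, r n ∈ repSums p q μ (⇑(∑' n, (u n).toC₀)) := repSums_tsum hr hrs hpt
  let v : HerzAlgebra p q μ :=
    ⟨⇑(∑' n, (u n).toC₀), ⟨_, rfl⟩, by obtain ⟨f, g, h, -⟩ := hmem; exact ⟨f, g, h⟩⟩
  refine ⟨v, ?_⟩
  rw [tendsto_iff_norm_sub_tendsto_zero]
  have htail : Tendsto (fun N => ∑' n, r (n + N)) atTop (𝓝 0) := tendsto_sum_nat_add r
  refine squeeze_zero (fun _ => norm_nonneg _) (fun N => ?_) htail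
  rw [norm_sub_rev]
  refine norm_le (repSums_tsum (fun n => hr (n + N)) ((summable_nat_add_iff N).2 hrs)
    fun x => ?_)
  have h1 := (hasSum_nat_add_iff' N).2 (hpt x)
  have h2 : (v - ∑ i ∈ Finset.range N, u i) x
      = (∑' n, (u n).toC₀) x - ∑ i ∈ Finset.range N, u i x := by
    have : (∑ i ∈ Finset.range N, u i) x = ∑ i ∈ Finset.range N, u i x :=
      map_sum (eval (p := p) (q := q) (μ := μ) x) u (Finset.range N)
    rw [coe_sub, this]
  rw [h2]
  exact h1

end HerzAlgebra

/-- `B_p(G)` as an algebra: the bounded continuous `u` with `uv ∈ A_p(G)` for all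
`v ∈ A_p(G)`. -/
def multiplierSubalgebra (p q : ℝ≥0∞) [p.HolderConjugate q] (μ : Measure G)
    [μ.IsMulLeftInvariant] : Subalgebra ℂ (G →ᵇ ℂ) where
  carrier := {u | ∀ v ∈ herzSubmodule p q μ, ⇑u * v ∈ herzSubmodule p q μ}
  mul_mem' {a b} ha hb v hv := by
    have := ha _ (hb v hv)
    rwa [← mul_assoc] at this
  add_mem' {a b} ha hb v hv := by
    have := Submodule.add_mem _ (ha v hv) (hb v hv)
    rwa [← add_mul] at this
  algebraMap_mem' c v hv := Submodule.smul_mem _ c hv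

/-- The multiplier algebra `B_p(G)` of `A_p(G)`.
(It is a type of its own, so that it carries the multiplier norm and no other topology.) -/
def MultiplierAlgebra (p q : ℝ≥0∞) [p.HolderConjugate q] (μ : Measure G)
    [μ.IsMulLeftInvariant] : Type _ := multiplierSubalgebra p q μ

namespace MultiplierAlgebra

variable {p q : ℝ≥0∞} [p.HolderConjugate q] {μ : Measure G} [μ.IsMulLeftInvariant]

instance : CommRing (MultiplierAlgebra p q μ) :=
  inferInstanceAs (CommRing (multiplierSubalgebra p q μ))

instance : Algebra ℂ (MultiplierAlgebra p q μ) :=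
  inferInstanceAs (Algebra ℂ (multiplierSubalgebra p q μ))

instance : CoeFun (MultiplierAlgebra p q μ) fun _ => G → ℂ :=
  ⟨fun u => (Subtype.val u : G →ᵇ ℂ)⟩

@[ext] theorem ext {u v : MultiplierAlgebra p q μ} (h : ∀ x, u x = v x) : u = v :=
  Subtype.ext (BoundedContinuousFunction.ext h)

theorem coe_add (u v : MultiplierAlgebra p q μ) (x : G) : (u + v) x = u x + v x := rfl
theorem coe_mul (u v : MultiplierAlgebra p q μ) (x : G) : (u * v) x = u x * v x := rfl
theorem coe_smul (c : ℂ) (u : MultiplierAlgebra p q μ) (x : G) : (c • u) x = c * u x := rfl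

/-- The product `uv ∈ A_p(G)` of `u ∈ B_p(G)` and `v ∈ A_p(G)`. -/
def act (u : MultiplierAlgebra p q μ) (v : HerzAlgebra p q μ) : HerzAlgebra p q μ :=
  ⟨fun x => u x * v x, u.2 _ v.2⟩

theorem act_apply (u : MultiplierAlgebra p q μ) (v : HerzAlgebra p q μ) (x : G) :
    u.act v x = u x * v x := rfl

/-- `‖u‖ = sup {‖uv‖ : v ∈ A_p(G), ‖v‖ ≤ 1}`. -/
instance : Norm (MultiplierAlgebra p q μ) :=
  ⟨fun u => sSup {r | ∃ v : HerzAlgebra p q μ, ‖v‖ ≤ 1 ∧ r = ‖u.act v‖}⟩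

theorem norm_def (u : MultiplierAlgebra p q μ) :
    ‖u‖ = sSup {r | ∃ v : HerzAlgebra p q μ, ‖v‖ ≤ 1 ∧ r = ‖u.act v‖} := rfl

/-- Multiplication by `u ∈ B_p(G)` as a linear map on `A_p(G)`. -/
def actLinear (u : MultiplierAlgebra p q μ) : HerzAlgebra p q μ →ₗ[ℂ] HerzAlgebra p q μ where
  toFun := u.act
  map_add' v w := by
    ext x
    simp only [act_apply, HerzAlgebra.coe_add, mul_add]
  map_smul' c v := by
    ext x
    simp only [act_apply, HerzAlgebra.coe_smul, RingHom.id_apply]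
    ring

/-- Multiplication by `u ∈ B_p(G)` is bounded on `A_p(G)`, by the closed graph theorem. -/
def actL (u : MultiplierAlgebra p q μ) : HerzAlgebra p q μ →L[ℂ] HerzAlgebra p q μ :=
  ContinuousLinearMap.ofSeqClosedGraph (g := u.actLinear) <| by
    intro s v w hs hw
    ext x
    have h1 := ((HerzAlgebra.eval (p := p) (q := q) (μ := μ) x).continuous.tendsto w).comp hw
    have h2 := (((HerzAlgebra.eval (p := p) (q := q) (μ := μ) x).continuous.tendsto v).comp
      hs).const_mul (u x)
    exact tendsto_nhds_unique h1 h2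

theorem actL_apply (u : MultiplierAlgebra p q μ) (v : HerzAlgebra p q μ) :
    u.actL v = u.act v := rfl

theorem norm_eq (u : MultiplierAlgebra p q μ) : ‖u‖ = ‖u.actL‖ := by
  rw [← u.actL.sSup_unitClosedBall_eq_norm, norm_def]
  congr 1
  ext r
  simp only [Set.mem_ofPred_eq, Set.mem_image, Metric.mem_closedBall, dist_zero_right,
    actL_apply]
  exact ⟨fun ⟨v, hv, h⟩ => ⟨v, hv, h.symm⟩, fun ⟨v, hv, h⟩ => ⟨v, hv, h.symm⟩⟩

theorem norm_act_le (u : MultiplierAlgebra p q μ) (v : HerzAlgebra p q μ) :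
    ‖u.act v‖ ≤ ‖u‖ * ‖v‖ := by
  rw [norm_eq]
  exact u.actL.le_opNorm v

end MultiplierAlgebra

end Topological

section LocallyCompact

variable {G : Type*} [Group G] [TopologicalSpace G] [IsTopologicalGroup G]
  [LocallyCompactSpace G] [MeasurableSpace G] [BorelSpace G]

/-- For every point there is a function in `A_p(G)` that does not vanish there. -/
theorem exists_apply_ne_zero (p q : ℝ≥0∞) [p.HolderConjugate q] (μ : Measure G)
    [μ.IsHaarMeasure] (x : G) : ∃ v : HerzAlgebra p q μ, v x ≠ 0 := by
  obtain ⟨φ, hφc, hφ0, hφ1⟩ :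
    ∃ φ : C(G, ℝ), HasCompactSupport φ ∧ 0 ≤ φ ∧ φ 1 ≠ 0 := exists_continuous_nonneg_pos 1
  let f : G → ℂ := fun y => (φ y : ℂ)
  let g : G → ℂ := fun y => (φ (x⁻¹ * y) : ℂ)
  have hf : Continuous f := by fun_prop
  have hg : Continuous g := by fun_prop
  have hfc : HasCompactSupport f := hφc.comp_left (g := fun r : ℝ => (r : ℂ)) (by simp)
  have hgc : HasCompactSupport g :=
    hfc.comp_homeomorph (Homeomorph.mulLeft x⁻¹)
  have hfp : MemLp f p μ := hf.memLp_of_hasCompactSupport hfc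
  have hgq : MemLp g q μ := hg.memLp_of_hasCompactSupport hgc
  let w : G → ℂ := fun z => ∫ y, g y * f (z⁻¹ * y) ∂μ
  have hwc : Continuous w := by
    rw [← continuousOn_univ]
    refine continuousOn_integral_of_compact_support (k := tsupport g) hgc ?_ ?_
    · exact Continuous.continuousOn (by fun_prop)
    · intro z y _ hy
      rw [image_eq_zero_of_notMem_tsupport hy, zero_mul]
  have hws : HasCompactSupport w := by
    refine HasCompactSupport.intro (hgc.isCompact.mul hfc.isCompact.inv) fun z hz => ?_
    refine integral_eq_zero_of_ae (Eventually.of_forall fun y => ?_)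
    by_contra h
    have h1 := mul_ne_zero_iff.1 h
    refine hz ⟨y, subset_tsupport _ h1.1, y⁻¹ * z, ?_, by simp⟩
    have := subset_tsupport _ h1.2
    simpa [Set.mem_inv] using this
  let c : C₀(G, ℂ) := ⟨⟨w, hwc⟩, hws.is_zero_at_infty⟩
  have hrep : IsRep p q μ w (fun i => if i = 0 then hfp.toLp f else 0)
      (fun i => if i = 0 then hgq.toLp g else 0) := by
    refine ⟨?_, fun z => ?_⟩
    · refine summable_of_ne_finset_zero (s := {0}) fun n hn => ?_
      have : n ≠ 0 := by simpa using hn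
      simp [this]
    · have hz : w z = conv μ (hgq.toLp g) (check (hfp.toLp f)) z := by
        rw [conv_check]
        refine integral_congr_ae ?_
        have h1 := (measurePreserving_mul_left μ z⁻¹).quasiMeasurePreserving.ae_eq_comp
          hfp.coeFn_toLp
        filter_upwards [hgq.coeFn_toLp, h1] with y hy hy'
        simp only [Function.comp_apply] at hy'
        rw [hy, hy']
      rw [hz]
      have := hasSum_single (f := fun i : ℕ =>
        conv μ ((if i = 0 then hgq.toLp g else 0 : Lp ℂ q μ))
          (check ((if i = 0 then hfp.toLp f else 0 : Lp ℂ p μ))) z) 0 ?_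
      · simpa using this
      · intro n hn
        simp only [hn, if_false]
        rw [conv_check, integral_eq_zero_of_ae]
        filter_upwards [Lp.coeFn_zero ℂ q μ] with y hy
        simp only [Pi.zero_apply] at hy ⊢
        rw [hy, zero_mul]
  refine ⟨⟨w, ⟨c, rfl⟩, _, _, hrep⟩, ?_⟩
  change w x ≠ 0
  have hwx : w x = ((∫ y, φ y * φ y ∂μ : ℝ) : ℂ) := by
    rw [← integral_mul_left_eq_self (fun y => φ y * φ y) x⁻¹, ← integral_complex_ofReal]
    refine integral_congr_ae (Eventually.of_forall fun y => ?_)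
    simp [f, g]
  rw [hwx]
  refine Complex.ofReal_ne_zero.2 (ne_of_gt ?_)
  have hφφ : Continuous fun y => φ y * φ y := by fun_prop
  exact hφφ.integral_pos_of_hasCompactSupport_nonneg_nonzero (x := 1)
    (hφc.mul_left (f := φ)) (fun y => mul_self_nonneg _) (mul_ne_zero hφ1 hφ1)

namespace MultiplierAlgebra

variable {p q : ℝ≥0∞} [p.HolderConjugate q] {μ : Measure G} [μ.IsHaarMeasure]

theorem core : NormedSpace.Core ℂ (MultiplierAlgebra p q μ) where
  norm_nonneg u := by rw [norm_eq]; exact norm_nonneg _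
  norm_smul c u := by
    rw [norm_eq, norm_eq, ← norm_smul]
    congr 1
    ext v x
    simp only [actL_apply, act_apply, coe_smul, _root_.smul_apply,
      HerzAlgebra.coe_smul, mul_assoc]
  norm_triangle u v := by
    rw [norm_eq, norm_eq, norm_eq]
    refine le_trans (le_of_eq ?_) (norm_add_le _ _)
    congr 1
    ext w x
    simp only [actL_apply, act_apply, coe_add, _root_.add_apply,
      HerzAlgebra.coe_add, add_mul]
  norm_eq_zero_iff u := by
    rw [norm_eq, norm_eq_zero]
    constructor
    · intro h
      ext x
      obtain ⟨v, hv⟩ := exists_apply_ne_zero p q μ x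
      have h1 : u.act v x = 0 := by
        rw [← actL_apply, h]; rfl
      rw [act_apply] at h1
      exact (mul_eq_zero.1 h1).resolve_right hv
    · rintro rfl
      ext v x
      rw [actL_apply, act_apply]
      exact zero_mul _

instance : NormedAddCommGroup (MultiplierAlgebra p q μ) := NormedAddCommGroup.ofCore core

instance : NormedCommRing (MultiplierAlgebra p q μ) :=
  { (inferInstance : NormedAddCommGroup (MultiplierAlgebra p q μ)),
    (inferInstance : CommRing (MultiplierAlgebra p q μ)) with
    norm_mul_le := fun u v => by
      rw [norm_eq, norm_eq, norm_eq]
      refine le_trans (le_of_eq ?_) (ContinuousLinearMap.opNorm_comp_le _ _)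
      congr 1
      ext w x
      simp only [actL_apply, act_apply, coe_mul, ContinuousLinearMap.comp_apply, mul_assoc] }

instance : NormedAlgebra ℂ (MultiplierAlgebra p q μ) :=
  { (inferInstance : Algebra ℂ (MultiplierAlgebra p q μ)) with
    norm_smul_le := fun c u => (core.norm_smul c u).le }

variable (p q μ) in
/-- The functional `I ∈ B_p(G)^*`, `I(u) = u(e)`. -/
def evalOne : StrongDual ℂ (MultiplierAlgebra p q μ) :=
  LinearMap.mkContinuousOfExistsBound
    { toFun := fun u => u 1, map_add' := fun _ _ => rfl, map_smul' := fun _ _ => rfl } <| by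
    obtain ⟨v, hv⟩ := exists_apply_ne_zero p q μ (1 : G)
    refine ⟨‖v‖ / ‖v 1‖, fun u => ?_⟩
    have h := ((u.act v).norm_apply_le 1).trans (u.norm_act_le v)
    rw [act_apply, norm_mul] at h
    have hv' : 0 < ‖v 1‖ := norm_pos_iff.2 hv
    change ‖u 1‖ ≤ _
    rw [div_mul_eq_mul_div, le_div_iff₀ hv']
    linarith

/-- The module action of `B_p(G)` on `B_p(G)^*`: `⟨φu, v⟩ = ⟨φ, uv⟩`. -/
def dualAct (φ : StrongDual ℂ (MultiplierAlgebra p q μ)) (u : MultiplierAlgebra p q μ) :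
    StrongDual ℂ (MultiplierAlgebra p q μ) :=
  φ.comp (ContinuousLinearMap.mul ℂ (MultiplierAlgebra p q μ) u)

theorem dualAct_apply (φ : StrongDual ℂ (MultiplierAlgebra p q μ))
    (u v : MultiplierAlgebra p q μ) : dualAct φ u v = φ (u * v) := rfl

/-- The module action of `B_p(G)` on `B_p(G)^{**}`: `⟨uF, φ⟩ = ⟨F, φu⟩`. -/
def bidualAct (u : MultiplierAlgebra p q μ)
    (F : StrongDual ℂ (StrongDual ℂ (MultiplierAlgebra p q μ))) :
    StrongDual ℂ (StrongDual ℂ (MultiplierAlgebra p q μ)) :=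
  F.comp ((ContinuousLinearMap.compL ℂ (MultiplierAlgebra p q μ) (MultiplierAlgebra p q μ) ℂ).flip
    (ContinuousLinearMap.mul ℂ (MultiplierAlgebra p q μ) u))

theorem bidualAct_apply (u : MultiplierAlgebra p q μ)
    (F : StrongDual ℂ (StrongDual ℂ (MultiplierAlgebra p q μ)))
    (φ : StrongDual ℂ (MultiplierAlgebra p q μ)) : bidualAct u F φ = F (dualAct φ u) := rfl

variable (p q μ) in
/-- The means on `B_p(G)^*`: the `F ∈ B_p(G)^{**}` with `‖F‖ = F(I) = 1`. -/
def means : Set (StrongDual ℂ (StrongDual ℂ (MultiplierAlgebra p q μ))) :=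
  {F | ‖F‖ = 1 ∧ F (evalOne p q μ) = 1}

end MultiplierAlgebra

end LocallyCompact

end Herz

end

/-! The functional `F` is a weak* cluster point in the bidual of a net `v U` in `B_p(G)`, indexed by
the open neighbourhoods `U` of `e`, with `‖v U‖ ≤ 1`, `v U 1 = 1` and `‖u * v U - u(e) v U‖ → 0` for
every `u` in `B_p(G)` (`MultiplierAlgebra.exists_invariant_net`). The limit then satisfies `uF =
u(e)F`, `F(I) = 1` and `‖F‖ ≤ 1`, and `‖I‖ ≤ 1` forces `‖F‖ = 1`.

The net consists of coefficients of vectors `f U`, `g U` of norm one supported in `U`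
(`exists_bump`). The main tool is `exists_diagonal_coef`: coefficients of the diagonal translation
action on `L^p(G × G)` lie in `A_p(G)`, with the expected norm bound. Indeed the shear `s = yt`
turns the diagonal action into translation of `y` alone with `t` as a parameter, so such a
coefficient is an `A_p`-valued integral of ordinary coefficients. On tensor products this shows that
`A_p(G)` is an algebra with submultiplicative norm (`exists_mul`).

It also gives the convergence. Let `u` be the coefficient of `a`, `b`. The product `u * v U` is the
diagonal coefficient of the tensors `f U ⊗ a`, `g U ⊗ b`. Replacing `a(y)` and `b(y)` by `a(s⁻¹y)`
and `b(s⁻¹y)` gives a diagonal coefficient equal to `u(e) v U`, because `s⁻¹y` is invariant under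
the diagonal action. As `s` stays in `U`, continuity of translation makes the two pairs of vectors
close in norm (`exists_ccCoef_mul_sub`, `ccNorm₂_tensor_sub_twist_le`). Density and a uniform bound
extend the convergence to `A_p(G)`; multiplying by an element of `A_p(G)` with value `1` at `e`
extends it to `B_p(G)`.

The Haar measure need not be σ-finite. All double integrals are therefore iterated integrals of
continuous functions with compact support, whose order can always be exchanged; general elements of
`A_p(G)` are reached by series (`exists_hasSum_ccCoef`). -/

open scoped CompactlySupported

noncomputable section

namespace Herz

set_option linter.unusedSectionVars false

/-! ### Continuous functions with compact support and their `L^r`-norms -/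

section CompactSupport

variable {X : Type*} [TopologicalSpace X] [MeasurableSpace X] [BorelSpace X]

/-- The `L^r`-norm of a continuous function with compact support. -/
def ccNorm (r : ℝ≥0∞) (μ : Measure X) (f : C_c(X, ℂ)) : ℝ :=
  (∫ y, ‖f y‖ ^ r.toReal ∂μ) ^ r.toReal⁻¹

theorem ccNorm_nonneg (r : ℝ≥0∞) (μ : Measure X) (f : C_c(X, ℂ)) : 0 ≤ ccNorm r μ f :=
  Real.rpow_nonneg (integral_nonneg fun _ => Real.rpow_nonneg (norm_nonneg _) _) _

theorem ccNorm_rpow {r : ℝ≥0∞} (hr : 0 < r.toReal) (μ : Measure X) (f : C_c(X, ℂ)) :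
    ccNorm r μ f ^ r.toReal = ∫ y, ‖f y‖ ^ r.toReal ∂μ :=
  Real.rpow_inv_rpow (integral_nonneg fun _ => Real.rpow_nonneg (norm_nonneg _) _) hr.ne'

theorem memLp_cc (r : ℝ≥0∞) (μ : Measure X) [IsFiniteMeasureOnCompacts μ] (f : C_c(X, ℂ)) :
    MemLp f r μ :=
  f.continuous.memLp_of_hasCompactSupport f.hasCompactSupport

theorem norm_toLp_cc {r : ℝ≥0∞} (hr : 0 < r.toReal) (μ : Measure X)
    [IsFiniteMeasureOnCompacts μ] (f : C_c(X, ℂ)) :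
    ‖(memLp_cc r μ f).toLp f‖ = ccNorm r μ f := by
  rw [Lp.norm_toLp, (memLp_cc r μ f).eLpNorm_eq_integral_rpow_norm
    (fun h => by simp [h] at hr) (fun h => by simp [h] at hr), ENNReal.toReal_ofReal]
  · rfl
  · exact ccNorm_nonneg r μ f

theorem continuous_integral_of_hasCompactSupport {Y : Type*} [TopologicalSpace Y] {E : Type*}
    [NormedAddCommGroup E] [NormedSpace ℝ E] (μ : Measure X) [IsFiniteMeasureOnCompacts μ]
    {F : Y → X → E} (hF : Continuous fun z : Y × X => F z.1 z.2) {K : Set X} (hK : IsCompact K)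
    (h0 : ∀ t, ∀ y ∉ K, F t y = 0) : Continuous fun t => ∫ y, F t y ∂μ := by
  rw [← continuousOn_univ]
  exact continuousOn_integral_of_compact_support hK hF.continuousOn fun t y _ hy => h0 t y hy

end CompactSupport

/-! ### Coefficient functions as elements of `A_p(G)` -/

section Coefficients

variable {G : Type*} [Group G] [TopologicalSpace G] [IsTopologicalGroup G]
  [MeasurableSpace G] [BorelSpace G]

section

variable {p q : ℝ≥0∞} [p.HolderConjugate q] {μ : Measure G} [μ.IsMulLeftInvariant]

theorem coef_mem_repSums (f : Lp ℂ p μ) (g : Lp ℂ q μ) :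
    ‖f‖ * ‖g‖ ∈ repSums p q μ (conv μ g (check f)) := by
  refine ⟨fun i => if i = 0 then f else 0, fun i => if i = 0 then g else 0, ⟨?_, fun z => ?_⟩, ?_⟩
  · refine summable_of_ne_finset_zero (s := {0}) fun n hn => ?_
    have : n ≠ 0 := by simpa using hn
    simp [this]
  · have := hasSum_single (f := fun i : ℕ =>
      conv μ ((if i = 0 then g else 0 : Lp ℂ q μ)) (check ((if i = 0 then f else 0 : Lp ℂ p μ))) z)
      0 ?_
    · simpa using this
    · intro n hn
      simp only [hn, if_false]
      rw [conv_check, integral_eq_zero_of_ae]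
      filter_upwards [Lp.coeFn_zero ℂ q μ] with y hy
      simp only [Pi.zero_apply] at hy ⊢
      rw [hy, zero_mul]
  · rw [tsum_eq_single 0]
    · simp
    · intro n hn
      simp [hn]

theorem eval_apply (x : G) (u : HerzAlgebra p q μ) : HerzAlgebra.eval x u = u x := rfl

end

variable {p q : ℝ≥0∞} [p.HolderConjugate q] {μ : Measure G} [IsFiniteMeasureOnCompacts μ]
  [μ.IsMulLeftInvariant]

theorem conv_toLp (f g : C_c(G, ℂ)) (x : G) :
    conv μ ((memLp_cc q μ g).toLp g) (check ((memLp_cc p μ f).toLp f)) x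
      = ∫ y, g y * f (x⁻¹ * y) ∂μ := by
  rw [conv_check]
  refine integral_congr_ae ?_
  have h1 := (measurePreserving_mul_left μ x⁻¹).quasiMeasurePreserving.ae_eq_comp
    (memLp_cc p μ f).coeFn_toLp
  filter_upwards [(memLp_cc q μ g).coeFn_toLp, h1] with y hy hy'
  simp only [Function.comp_apply] at hy'
  rw [hy, hy']

variable (p q μ) in
/-- The coefficient function `x ↦ ∫ g(y) f(x⁻¹y) dy`, for continuous `f`, `g` with compact
support, as an element of `A_p(G)`. -/
def ccCoef (f g : C_c(G, ℂ)) : HerzAlgebra p q μ :=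
  ⟨fun x => ∫ y, g y * f (x⁻¹ * y) ∂μ, by
    have hc : Continuous fun x => ∫ y, g y * f (x⁻¹ * y) ∂μ :=
      continuous_integral_of_hasCompactSupport μ (by fun_prop) g.hasCompactSupport.isCompact
        fun t y hy => by rw [image_eq_zero_of_notMem_tsupport hy, zero_mul]
    have hs : HasCompactSupport fun x => ∫ y, g y * f (x⁻¹ * y) ∂μ := by
      refine HasCompactSupport.intro
        (g.hasCompactSupport.isCompact.mul f.hasCompactSupport.isCompact.inv) fun z hz => ?_
      refine integral_eq_zero_of_ae (Eventually.of_forall fun y => ?_)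
      by_contra h
      have h1 := mul_ne_zero_iff.1 h
      refine hz ⟨y, subset_tsupport _ h1.1, y⁻¹ * z, ?_, by simp⟩
      have := subset_tsupport _ h1.2
      simpa [Set.mem_inv] using this
    refine ⟨⟨⟨⟨_, hc⟩, hs.is_zero_at_infty⟩, rfl⟩, ?_⟩
    obtain ⟨F, G', h, -⟩ := coef_mem_repSums ((memLp_cc p μ f).toLp f) ((memLp_cc q μ g).toLp g)
    refine ⟨F, G', h.summable, fun x => ?_⟩
    rw [← conv_toLp (p := p) (q := q)]
    exact h.hasSum x⟩

theorem ccCoef_apply (f g : C_c(G, ℂ)) (x : G) :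
    ccCoef p q μ f g x = ∫ y, g y * f (x⁻¹ * y) ∂μ := rfl

theorem coe_ccCoef (f g : C_c(G, ℂ)) : (ccCoef p q μ f g : G → ℂ)
    = conv μ ((memLp_cc q μ g).toLp g) (check ((memLp_cc p μ f).toLp f)) :=
  funext fun x => (conv_toLp f g x).symm

theorem norm_ccCoef_le_toLp (f g : C_c(G, ℂ)) : ‖ccCoef p q μ f g‖
    ≤ ‖(memLp_cc p μ f).toLp f‖ * ‖(memLp_cc q μ g).toLp g‖ := by
  refine HerzAlgebra.norm_le (p := p) (q := q) (μ := μ) ?_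
  rw [coe_ccCoef f g]
  exact coef_mem_repSums _ _

theorem norm_ccCoef_le (hp : 0 < p.toReal) (hq : 0 < q.toReal) (f g : C_c(G, ℂ)) :
    ‖ccCoef p q μ f g‖ ≤ ccNorm p μ f * ccNorm q μ g := by
  rw [← norm_toLp_cc hp, ← norm_toLp_cc hq]
  exact norm_ccCoef_le_toLp f g

theorem integrable_mul_cc (f g : C_c(G, ℂ)) (x : G) :
    Integrable (fun y => g y * f (x⁻¹ * y)) μ :=
  Continuous.integrable_of_hasCompactSupport (by fun_prop)
    (g.hasCompactSupport.mul_right (f' := fun y => f (x⁻¹ * y)))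

/-- Bilinearity in telescoped form: each term on the right is small once one vector is close to its
replacement and the other stays bounded. -/
theorem ccCoef_sub (f g f' g' : C_c(G, ℂ)) : ccCoef p q μ f g - ccCoef p q μ f' g'
    = ccCoef p q μ (f - f') g + ccCoef p q μ f' (g - g') := by
  ext x
  simp only [HerzAlgebra.coe_sub, HerzAlgebra.coe_add, ccCoef_apply]
  rw [← integral_sub (integrable_mul_cc f g x) (integrable_mul_cc f' g' x),
    ← integral_add (integrable_mul_cc (f - f') g x) (integrable_mul_cc f' (g - g') x)]
  refine integral_congr_ae (Eventually.of_forall fun y => ?_)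
  simp only [CompactlySupportedContinuousMap.coe_sub, Pi.sub_apply]
  ring

end Coefficients

/-! ### Slices of functions on a product, and iterated `L^r`-norms -/

section Slices

variable {X : Type*} [TopologicalSpace X] [R1Space X]

/-- The function `f(t, ·)`. -/
def slice (f : C_c(X × X, ℂ)) (t : X) : C_c(X, ℂ) :=
  ⟨⟨fun y => f (t, y), by fun_prop⟩, HasCompactSupport.intro
    (f.hasCompactSupport.isCompact.image continuous_snd) fun y hy => by
      by_contra h
      exact hy ⟨(t, y), subset_tsupport _ h, rfl⟩⟩

theorem slice_apply (f : C_c(X × X, ℂ)) (t y : X) : slice f t y = f (t, y) := rfl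

theorem slice_eq_zero {f : C_c(X × X, ℂ)} {t : X} (ht : t ∉ Prod.fst '' tsupport f) :
    slice f t = 0 := by
  ext y
  by_contra h
  exact ht ⟨(t, y), subset_tsupport _ h, rfl⟩

variable [MeasurableSpace X] [BorelSpace X]

/-- The fixed `h` is there to be taken as a slice `slice f s`: continuity at `s` then says that the
slices converge in `L^r`-norm, without passing to classes in `Lp`. -/
theorem continuous_ccNorm_slice_sub {r : ℝ≥0∞} (hr : 0 < r.toReal) (μ : Measure X)
    [IsFiniteMeasureOnCompacts μ] (f : C_c(X × X, ℂ)) (h : C_c(X, ℂ)) :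
    Continuous fun t => ccNorm r μ (slice f t - h) := by
  refine Continuous.rpow_const ?_ fun _ => Or.inr (inv_nonneg.2 hr.le)
  have hK := (f.hasCompactSupport.isCompact.image continuous_snd).union
    h.hasCompactSupport.isCompact
  refine continuous_integral_of_hasCompactSupport μ ?_ hK fun t y hy => ?_
  · refine Continuous.rpow_const ?_ fun _ => Or.inr hr.le
    exact (f.continuous.sub (h.continuous.comp continuous_snd)).norm
  · have h1 : f (t, y) = 0 := by
      by_contra h'
      exact hy (Or.inl ⟨(t, y), subset_tsupport _ h', rfl⟩)
    have h2 : h y = 0 := image_eq_zero_of_notMem_tsupport fun h' => hy (Or.inr h')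
    simp [slice_apply, h1, h2, Real.zero_rpow hr.ne']

theorem ccNorm_zero {r : ℝ≥0∞} (hr : 0 < r.toReal) (μ : Measure X) :
    ccNorm r μ (0 : C_c(X, ℂ)) = 0 := by
  simp [ccNorm, Real.zero_rpow hr.ne', Real.zero_rpow (inv_ne_zero hr.ne')]

theorem continuous_ccNorm_slice {r : ℝ≥0∞} (hr : 0 < r.toReal) (μ : Measure X)
    [IsFiniteMeasureOnCompacts μ] (f : C_c(X × X, ℂ)) :
    Continuous fun t => ccNorm r μ (slice f t) := by
  simpa using continuous_ccNorm_slice_sub hr μ f 0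

theorem hasCompactSupport_ccNorm_slice {r : ℝ≥0∞} (hr : 0 < r.toReal) (μ : Measure X)
    (f : C_c(X × X, ℂ)) : HasCompactSupport fun t => ccNorm r μ (slice f t) :=
  HasCompactSupport.intro (f.hasCompactSupport.isCompact.image continuous_fst) fun t ht => by
    rw [slice_eq_zero ht, ccNorm_zero hr]

/-- The `L^r`-norm of a continuous function with compact support on `X × X`. -/
def ccNorm₂ (r : ℝ≥0∞) (μ : Measure X) (f : C_c(X × X, ℂ)) : ℝ :=
  (∫ y, ∫ s, ‖f (s, y)‖ ^ r.toReal ∂μ ∂μ) ^ r.toReal⁻¹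

/-- Both orders are needed: the shear moves `s` for fixed `y`, whereas slices and twists are
integrated in `y` for fixed first variable. -/
theorem integral_norm_rpow_swap {r : ℝ≥0∞} (hr : 0 < r.toReal) (μ : Measure X)
    [IsFiniteMeasureOnCompacts μ] (f : C_c(X × X, ℂ)) :
    ∫ y, ∫ s, ‖f (s, y)‖ ^ r.toReal ∂μ ∂μ = ∫ s, ∫ y, ‖f (s, y)‖ ^ r.toReal ∂μ ∂μ := by
  refine (integral_integral_swap_of_hasCompactSupport
    (f := fun s y => ‖f (s, y)‖ ^ r.toReal) ?_ ?_).symm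
  · exact Continuous.rpow_const (f := fun z : X × X => ‖f (z.1, z.2)‖) f.continuous.norm
      fun _ => Or.inr hr.le
  · exact f.hasCompactSupport.comp_left (g := fun c : ℂ => ‖c‖ ^ r.toReal)
      (by simp [Real.zero_rpow hr.ne'])

end Slices

/-! ### The diagonal action on `L^p(G × G)` and the shear -/

section Diagonal

variable {G : Type*} [Group G] [TopologicalSpace G] [IsTopologicalGroup G]

/-- The shear `(t, y) ↦ (yt, y)` of `G × G`. -/
def shear (G : Type*) [Group G] [TopologicalSpace G] [IsTopologicalGroup G] : G × G ≃ₜ G × G where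
  toFun z := (z.2 * z.1, z.2)
  invFun z := (z.2⁻¹ * z.1, z.2)
  left_inv z := by simp
  right_inv z := by simp
  continuous_toFun := by fun_prop
  continuous_invFun := by fun_prop

/-- The function `(t, y) ↦ f(yt, y)`. -/
def shearCc (f : C_c(G × G, ℂ)) : C_c(G × G, ℂ) :=
  ⟨⟨f ∘ shear G, f.continuous.comp (shear G).continuous⟩,
    f.hasCompactSupport.comp_homeomorph (shear G)⟩

theorem shearCc_apply (f : C_c(G × G, ℂ)) (t y : G) : shearCc f (t, y) = f (y * t, y) := rfl

variable [MeasurableSpace G] [BorelSpace G]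

theorem ccNorm₂_shearCc {r : ℝ≥0∞} (μ : Measure G) [μ.IsMulLeftInvariant] (f : C_c(G × G, ℂ)) :
    ccNorm₂ r μ (shearCc f) = ccNorm₂ r μ f := by
  unfold ccNorm₂
  congr 2
  funext y
  exact integral_mul_left_eq_self (fun s => ‖f (s, y)‖ ^ r.toReal) y

variable {p q : ℝ≥0∞} [p.HolderConjugate q] {μ : Measure G} [IsFiniteMeasureOnCompacts μ]
  [μ.IsMulLeftInvariant]

theorem continuous_ccCoef_slice (hp : 0 < p.toReal) (hq : 0 < q.toReal) (a b : C_c(G × G, ℂ)) :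
    Continuous fun t => ccCoef p q μ (slice b t) (slice a t) := by
  rw [continuous_iff_continuousAt]
  intro s
  rw [ContinuousAt, tendsto_iff_norm_sub_tendsto_zero]
  have hb : Continuous fun t => ccNorm p μ (slice b t - slice b s) * ccNorm q μ (slice a t)
      + ccNorm p μ (slice b s) * ccNorm q μ (slice a t - slice a s) := ((continuous_ccNorm_slice_sub hp μ b (slice b s)).mul
    (continuous_ccNorm_slice hq μ a)).add
    ((continuous_ccNorm_slice_sub hq μ a (slice a s)).const_mul (ccNorm p μ (slice b s)))
  have h0 := hb.tendsto s
  simp only [sub_self, ccNorm_zero hp, ccNorm_zero hq, zero_mul, mul_zero, add_zero] at h0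
  refine squeeze_zero (fun _ => norm_nonneg _) (fun t => ?_) h0
  rw [ccCoef_sub]
  exact (norm_add_le _ _).trans (add_le_add (norm_ccCoef_le hp hq _ _) (norm_ccCoef_le hp hq _ _))

/-- The coefficients of the diagonal action of `G` on `L^p(G × G)` are in `A_p(G)`. -/
theorem exists_diagonal_coef (hp : 0 < p.toReal) (hq : 0 < q.toReal) (a b : C_c(G × G, ℂ)) :
    ∃ w : HerzAlgebra p q μ,
      (∀ x, w x = ∫ y, ∫ s, a (s, y) * b (x⁻¹ * s, x⁻¹ * y) ∂μ ∂μ) ∧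
      ‖w‖ ≤ ccNorm₂ q μ a * ccNorm₂ p μ b := by
  set A := shearCc a with hA
  set B := shearCc b with hB
  have hc := continuous_ccCoef_slice (μ := μ) hp hq A B
  have hs : HasCompactSupport fun t => ccCoef p q μ (slice B t) (slice A t) :=
    HasCompactSupport.intro (A.hasCompactSupport.isCompact.image continuous_fst) fun t ht => by
      ext x
      rw [ccCoef_apply, slice_eq_zero ht, HerzAlgebra.coe_zero]
      simp
  have hi : Integrable (fun t => ccCoef p q μ (slice B t) (slice A t)) μ :=
    hc.integrable_of_hasCompactSupport hs
  -- The element is a Bochner integral in the Banach space `A_p(G)`. Evaluation at `x` is a bounded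
  -- functional, so it passes under the integral, and `s = yt` undoes the shear. The norm bound is
  -- Hölder's inequality in `t`.
  refine ⟨∫ t, ccCoef p q μ (slice B t) (slice A t) ∂μ, fun x => ?_, ?_⟩
  · have h1 := ContinuousLinearMap.integral_comp_comm (HerzAlgebra.eval x) hi
    simp only [eval_apply, ccCoef_apply, slice_apply] at h1
    rw [← h1]
    rw [integral_integral_swap_of_hasCompactSupport
      (f := fun t y => A (t, y) * B (t, x⁻¹ * y))
      (A.continuous.mul (B.continuous.comp (by fun_prop : Continuous fun z : G × G =>
        (z.1, x⁻¹ * z.2))))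
      (A.hasCompactSupport.mono fun _ hz => left_ne_zero_of_mul hz)]
    congr 1
    funext y
    rw [← integral_mul_left_eq_self (fun s => a (s, y) * b (x⁻¹ * s, x⁻¹ * y)) y]
    simp only [hA, hB, shearCc_apply, mul_assoc]
  · have hpq : q.toReal.HolderConjugate p.toReal := by
      have := ENNReal.HolderTriple.toReal (p := p) (q := q) 1 hp hq
      rw [ENNReal.toReal_one] at this
      exact this.symm
    have hAq := continuous_ccNorm_slice hq μ A
    have hBp := continuous_ccNorm_slice hp μ B
    have hAs := hasCompactSupport_ccNorm_slice hq μ A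
    have hBs := hasCompactSupport_ccNorm_slice hp μ B
    calc ‖∫ t, ccCoef p q μ (slice B t) (slice A t) ∂μ‖
        ≤ ∫ t, ccNorm q μ (slice A t) * ccNorm p μ (slice B t) ∂μ := by
          refine norm_integral_le_of_norm_le ?_ (Eventually.of_forall fun t => ?_)
          · exact (hAq.mul hBp).integrable_of_hasCompactSupport (hAs.mul_right)
          · rw [mul_comm]
            exact norm_ccCoef_le hp hq _ _
      _ ≤ (∫ t, ccNorm q μ (slice A t) ^ q.toReal ∂μ) ^ (1 / q.toReal)
          * (∫ t, ccNorm p μ (slice B t) ^ p.toReal ∂μ) ^ (1 / p.toReal) :=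
          integral_mul_le_Lp_mul_Lq_of_nonneg hpq
            (Eventually.of_forall fun t => ccNorm_nonneg _ _ _)
            (Eventually.of_forall fun t => ccNorm_nonneg _ _ _)
            (hAq.memLp_of_hasCompactSupport hAs) (hBp.memLp_of_hasCompactSupport hBs)
      _ = ccNorm₂ q μ a * ccNorm₂ p μ b := by
          simp only [ccNorm_rpow hp, ccNorm_rpow hq, one_div]
          rw [← ccNorm₂_shearCc μ a, ← ccNorm₂_shearCc μ b, ccNorm₂, ccNorm₂,
            integral_norm_rpow_swap hp, integral_norm_rpow_swap hq]
          rfl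

end Diagonal

section

/-! ### Approximation in `L^r` by continuous functions with compact support -/

section Density

variable {X : Type*} [TopologicalSpace X] [R1Space X] [LocallyCompactSpace X]
  [MeasurableSpace X] [BorelSpace X]

/-- Density of the continuous functions with compact support in `L^r` for a regular measure on a
locally compact space that need not be normal. -/
theorem exists_cc_eLpNorm_sub_le {r : ℝ≥0∞} (hr : r ≠ ∞) {μ : Measure X} [μ.Regular] {f : X → ℂ}
    (hf : MemLp f r μ) {ε : ℝ≥0∞} (hε : ε ≠ 0) : ∃ g : C_c(X, ℂ), eLpNorm (f - ⇑g) r μ ≤ ε := by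
  suffices H : ∃ g : X → ℂ, eLpNorm (f - g) r μ ≤ ε ∧ (Continuous g ∧ HasCompactSupport g) by
    obtain ⟨g, hg, hc, hs⟩ := H
    exact ⟨⟨⟨g, hc⟩, hs⟩, hg⟩
  refine hf.induction_dense hr (P := fun g : X → ℂ => Continuous g ∧ HasCompactSupport g)
    ?_ ?_ ?_ hε
  · intro c t ht htμ ε hε
    obtain ⟨η, hη0, hη⟩ := exists_eLpNorm_indicator_le (μ := μ) hr c hε
    have hη' : (η : ℝ≥0∞) / 2 ≠ 0 := by simpa using hη0.ne'
    obtain ⟨s, hst, hs, hsc, hμs⟩ := ht.exists_isCompact_isClosed_sdiff_lt htμ.ne hη'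
    obtain ⟨V, hsV, hV, -, hμV⟩ := hsc.measurableSet.exists_isOpen_sdiff_lt
      ((measure_mono hst).trans_lt htμ).ne hη'
    obtain ⟨φ, hφs, hφV, hφc, hφ⟩ := exists_continuous_one_zero_of_isCompact hs
      hV.isClosed_compl (Set.disjoint_compl_right_iff_subset.2 hsV)
    refine ⟨fun x => φ x * c, ?_, by fun_prop, ?_⟩
    -- The approximant agrees with the indicator on `s` and off `V ∪ t`; elsewhere the error is at
    -- most `‖c‖`, on a set of measure at most `η`.
    · refine le_trans (eLpNorm_mono fun x => ?_) (hη ((V \ s) ∪ (t \ s)) ?_)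
      · have hn : ‖(φ x : ℂ)‖ ≤ 1 := by
          rw [Complex.norm_real, Real.norm_of_nonneg (hφ x).1]
          exact (hφ x).2
        have hn' : ‖(φ x : ℂ) - 1‖ ≤ 1 := by
          rw [← Complex.ofReal_one, ← Complex.ofReal_sub, Complex.norm_real, Real.norm_eq_abs,
            abs_le]
          constructor <;> linarith [(hφ x).1, (hφ x).2]
        by_cases hxs : x ∈ s
        · have h1 : φ x = 1 := hφs hxs
          simp [h1, hst hxs, hxs]
        · by_cases hxt : x ∈ t
          · have h1 : (φ x : ℂ) * c - c = ((φ x : ℂ) - 1) * c := by ring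
            simp only [Pi.sub_apply, Set.indicator_of_mem hxt, h1, norm_mul]
            rw [Set.indicator_of_mem (show x ∈ V \ s ∪ t \ s from Or.inr ⟨hxt, hxs⟩)]
            exact mul_le_of_le_one_left (norm_nonneg c) hn'
          · simp only [Pi.sub_apply, Set.indicator_of_notMem hxt, sub_zero, norm_mul]
            by_cases hxV : x ∈ V
            · rw [Set.indicator_of_mem (show x ∈ V \ s ∪ t \ s from Or.inl ⟨hxV, hxs⟩)]
              exact mul_le_of_le_one_left (norm_nonneg c) hn
            · have h1 : φ x = 0 := hφV hxV
              simp [h1]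
      · refine (measure_union_le _ _).trans ((add_le_add hμV.le hμs.le).trans ?_)
        rw [ENNReal.add_halves]
    · exact (hφc.comp_left (g := fun r : ℝ => (r : ℂ)) (by simp)).mul_right
  · rintro f g ⟨hf, hf'⟩ ⟨hg, hg'⟩
    exact ⟨hf.add hg, hf'.add hg'⟩
  · rintro f ⟨hf, hf'⟩
    exact (hf.memLp_of_hasCompactSupport (p := r) hf').1

/-- Every `f ∈ L^r` is an absolutely convergent sum of continuous functions with compact support,
with almost optimal sum of norms. -/
theorem exists_cc_hasSum {r : ℝ≥0∞} [Fact (1 ≤ r)] (hr : 0 < r.toReal) {μ : Measure X}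
    [μ.Regular] (f : Lp ℂ r μ) {ε : ℝ} (hε : 0 < ε) :
    ∃ h : ℕ → C_c(X, ℂ), Summable (fun n => ccNorm r μ (h n)) ∧
      HasSum (fun n => (memLp_cc r μ (h n)).toLp (h n)) f ∧
      ∑' n, ccNorm r μ (h n) ≤ ‖f‖ + ε := by
  let s : AddSubgroup (Lp ℂ r μ) :=
    { carrier := Set.range fun h : C_c(X, ℂ) => (memLp_cc r μ h).toLp h
      zero_mem' := ⟨0, MemLp.toLp_zero (memLp_cc r μ 0)⟩
      add_mem' := by
        rintro _ _ ⟨h, rfl⟩ ⟨k, rfl⟩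
        exact ⟨h + k, MemLp.toLp_add (memLp_cc r μ h) (memLp_cc r μ k)⟩
      neg_mem' := by
        rintro _ ⟨h, rfl⟩
        exact ⟨-h, MemLp.toLp_neg (memLp_cc r μ h)⟩ }
  have hf : f ∈ closure (s : Set (Lp ℂ r μ)) := by
    rw [Metric.mem_closure_iff]
    intro δ hδ
    obtain ⟨h, hg⟩ := exists_cc_eLpNorm_sub_le
      (fun h => by simp [h] at hr) (Lp.memLp f) (ε := ENNReal.ofReal (δ / 2)) (by simpa using hδ)
    refine ⟨(memLp_cc r μ h).toLp h, ⟨h, rfl⟩, ?_⟩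
    rw [dist_eq_norm, Lp.norm_def]
    have h1 : eLpNorm (f - (memLp_cc r μ h).toLp h : Lp ℂ r μ) r μ = eLpNorm (⇑f - ⇑h) r μ := by
      refine eLpNorm_congr_ae ((Lp.coeFn_sub _ _).trans ?_)
      exact EventuallyEq.rfl.sub (memLp_cc r μ h).coeFn_toLp
    rw [h1]
    refine lt_of_le_of_lt (ENNReal.toReal_mono ENNReal.ofReal_ne_top hg) ?_
    rw [ENNReal.toReal_ofReal (by positivity)]
    linarith
  obtain ⟨v, hv, hvs, hv0, hvn⟩ := controlled_sum_of_mem_closure hf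
    (b := fun n => ε / 2 / 2 ^ n) (fun n => by positivity)
  choose h hh using hvs
  have hn : ∀ n, ccNorm r μ (h n) = ‖v n‖ := fun n => by
    rw [← norm_toLp_cc hr]
    exact congrArg norm (hh n)
  -- The zeroth term approximates `f` itself, so it alone costs `‖f‖`; the errors `ε / 2 / 2 ^ n`
  -- add up to `ε`.
  have hle : ∀ n, ‖v n‖ ≤ (if n = 0 then ‖f‖ else 0) + ε / 2 / 2 ^ n := by
    intro n
    by_cases h0 : n = 0
    · subst h0
      have := norm_sub_le f (-v 0 + f)
      rw [show f - (-v 0 + f) = v 0 by abel] at this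
      simp only [if_true]
      linarith
    · simpa [h0] using (hvn n (Nat.pos_of_ne_zero h0)).le
  have hb : HasSum (fun n => (if n = 0 then ‖f‖ else 0) + ε / 2 / 2 ^ n) (‖f‖ + ε) :=
    (hasSum_ite_eq 0 ‖f‖).add (hasSum_geometric_two' ε)
  have hsn : Summable fun n => ‖v n‖ := hb.summable.of_nonneg_of_le (fun _ => norm_nonneg _) hle
  refine ⟨h, ?_, ?_, ?_⟩
  · simpa only [hn] using hsn
  · have h1 : (fun n => (memLp_cc r μ (h n)).toLp (h n)) = v := funext hh
    rw [h1]
    have h2 := hsn.of_norm.hasSum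
    -- The shift is needed because `hv` concerns the partial sums over `range (n + 1)`.
    have h3 := h2.tendsto_sum_nat.comp (tendsto_add_atTop_nat 1)
    rwa [tendsto_nhds_unique h3 hv] at h2
  · simp only [hn]
    rw [← hb.tsum_eq]
    exact hsn.tsum_le_tsum hle hb.summable

end Density

variable {G : Type*} [Group G] [TopologicalSpace G] [IsTopologicalGroup G]
  [MeasurableSpace G] [BorelSpace G]

/-! ### Representing `A_p(G)` by continuous vectors with compact support -/

section Pairing

variable {p q : ℝ≥0∞} [p.HolderConjugate q] {μ : Measure G} [μ.IsMulLeftInvariant]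

/-- The value at `x` of the coefficient function of `f ∈ L^p(G)` and `g ∈ L^q(G)` is a continuous
bilinear function of `g` and `f`. -/
theorem exists_conv_bilinear [Fact (1 ≤ p)] [Fact (1 ≤ q)] (x : G) :
    ∃ B : Lp ℂ q μ →L[ℂ] Lp ℂ p μ →L[ℂ] ℂ, 
      ∀ (g : Lp ℂ q μ) (f : Lp ℂ p μ), conv μ g (check f) x = B g f := by
  have hmp : MeasurePreserving (fun y => x⁻¹ * y) μ μ := measurePreserving_mul_left μ x⁻¹
  let T : Lp ℂ p μ →L[ℂ] Lp ℂ p μ := (Lp.compMeasurePreservingₗᵢ ℂ _ hmp).toContinuousLinearMap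
  refine ⟨(T.precomp ℂ).comp
    ((ContinuousLinearMap.mul ℂ ℂ).lpPairing μ q p), fun g f => ?_⟩
  have h : (T.precomp ℂ).comp ((ContinuousLinearMap.mul ℂ ℂ).lpPairing μ q p) g f
    = (ContinuousLinearMap.mul ℂ ℂ).lpPairing μ q p g (T f) := rfl
  rw [h, ContinuousLinearMap.lpPairing_eq_integral, conv_check]
  refine integral_congr_ae ?_
  filter_upwards [Lp.coeFn_compMeasurePreserving f hmp] with y hy
  exact congrArg (g y * ·) hy.symm

end Pairing

section CompactSums

variable {p q : ℝ≥0∞} [p.HolderConjugate q] {μ : Measure G} [IsFiniteMeasureOnCompacts μ]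
  [μ.IsMulLeftInvariant]

variable (p q μ) in
/-- The numbers `∑ᵢ ‖fᵢ‖_p ‖gᵢ‖_q` over the representations `u = ∑ᵢ gᵢ * fᵢ^∨` with continuous
`fᵢ`, `gᵢ` of compact support. -/
def ccSums (u : G → ℂ) : Set ℝ :=
  {r | ∃ f g : ℕ → C_c(G, ℂ), Summable (fun i => ccNorm p μ (f i) * ccNorm q μ (g i)) ∧
    (∀ x, HasSum (fun i => ccCoef p q μ (f i) (g i) x) (u x)) ∧
    r = ∑' i, ccNorm p μ (f i) * ccNorm q μ (g i)}

theorem ccNorm_mul_nonneg (f g : C_c(G, ℂ)) : 0 ≤ ccNorm p μ f * ccNorm q μ g :=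
  mul_nonneg (ccNorm_nonneg _ _ _) (ccNorm_nonneg _ _ _)

theorem ccSums_nonneg {u : G → ℂ} {r : ℝ} (hr : r ∈ ccSums p q μ u) : 0 ≤ r := by
  obtain ⟨f, g, -, -, rfl⟩ := hr
  exact tsum_nonneg fun i => ccNorm_mul_nonneg _ _

theorem ccSums_single (hp : 0 < p.toReal) (f g : C_c(G, ℂ)) :
    ccNorm p μ f * ccNorm q μ g ∈ ccSums p q μ (ccCoef p q μ f g) := by
  have h0 : ∀ n : ℕ, n ≠ 0 → ccNorm p μ (if n = 0 then f else 0)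
      * ccNorm q μ g = 0 := fun n hn => by
    simp [hn, ccNorm_zero hp]
  refine ⟨fun i => if i = 0 then f else 0, fun _ => g, ?_, fun x => ?_, ?_⟩
  · exact summable_of_ne_finset_zero (s := {0}) fun n hn => h0 n (by simpa using hn)
  · have := hasSum_single (f := fun i : ℕ => ccCoef p q μ (if i = 0 then f else 0) g x) 0 ?_
    · simpa using this
    · intro n hn
      simp [hn, ccCoef_apply]
  · rw [tsum_eq_single 0 h0]
    simp

theorem norm_ccCoef_apply_le (hp : 0 < p.toReal) (hq : 0 < q.toReal) (f g : C_c(G, ℂ)) (x : G) :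
    ‖ccCoef p q μ f g x‖ ≤ ccNorm p μ f * ccNorm q μ g :=
  ((ccCoef p q μ f g).norm_apply_le x).trans (norm_ccCoef_le hp hq f g)

theorem ccSums_tsum (hp : 0 < p.toReal) (hq : 0 < q.toReal) {u : ℕ → G → ℂ} {r : ℕ → ℝ}
    (hr : ∀ n, r n ∈ ccSums p q μ (u n)) (hs : Summable r) {v : G → ℂ}
    (hv : ∀ x, HasSum (fun n => u n x) (v x)) : ∑' n, r n ∈ ccSums p q μ v := by
  choose f g hsum h hrs using hr
  let e : ℕ ≃ ℕ × ℕ := Nat.pairEquiv.symm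
  have hsum' : Summable fun z : ℕ × ℕ => ccNorm p μ (f z.1 z.2) * ccNorm q μ (g z.1 z.2) := by
    rw [summable_prod_of_nonneg (fun z => ccNorm_mul_nonneg _ _)]
    refine ⟨hsum, ?_⟩
    simpa only [← hrs] using hs
  refine ⟨fun k => f (e k).1 (e k).2, fun k => g (e k).1 (e k).2, ?_, fun x => ?_, ?_⟩
  · exact (e.summable_iff
      (f := fun z : ℕ × ℕ => ccNorm p μ (f z.1 z.2) * ccNorm q μ (g z.1 z.2))).2 hsum'
  · refine (e.hasSum_iff (f := fun z : ℕ × ℕ => ccCoef p q μ (f z.1 z.2) (g z.1 z.2) x)).2 ?_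
    have hc : Summable fun z : ℕ × ℕ => ccCoef p q μ (f z.1 z.2) (g z.1 z.2) x :=
      Summable.of_norm_bounded hsum' fun z => norm_ccCoef_apply_le hp hq _ _ x
    have := hc.hasSum.prod_fiberwise fun n => h n x
    rw [(hv x).unique this]
    exact hc.hasSum
  · rw [e.tsum_eq (fun z : ℕ × ℕ => ccNorm p μ (f z.1 z.2) * ccNorm q μ (g z.1 z.2)),
      hsum'.tsum_prod]
    exact tsum_congr hrs

end CompactSums

section Regular

variable [LocallyCompactSpace G] {p q : ℝ≥0∞} [p.HolderConjugate q] {μ : Measure G} [μ.Regular]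
  [μ.IsMulLeftInvariant]

/-- Both vectors are expanded in series of continuous functions with compact support. The value at
`x` is continuous and bilinear, so the double series can be summed first over the expansion of `g`,
then over that of `f`. -/
theorem exists_ccSums_conv [Fact (1 ≤ p)] [Fact (1 ≤ q)] (hp : 0 < p.toReal) (hq : 0 < q.toReal)
    (f : Lp ℂ p μ) (g : Lp ℂ q μ) {ε : ℝ} (hε : 0 < ε) :
    ∃ r ∈ ccSums p q μ (conv μ g (check f)), r ≤ ‖f‖ * ‖g‖ + ε := by
  obtain ⟨δ, hδ, hδε⟩ : ∃ δ > 0, (‖f‖ + δ) * (‖g‖ + δ) < ‖f‖ * ‖g‖ + ε := by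
    have hc : Continuous fun δ : ℝ => (‖f‖ + δ) * (‖g‖ + δ) := by fun_prop
    have h0 := (hc.tendsto 0).eventually_lt_const (u := ‖f‖ * ‖g‖ + ε) (by simpa using hε)
    have h1 := (h0.filter_mono nhdsWithin_le_nhds).and (self_mem_nhdsWithin (s := Set.Ioi (0 : ℝ)))
    obtain ⟨δ, h, h'⟩ := h1.exists
    exact ⟨δ, h', h⟩
  obtain ⟨F, hF, hFs, hFle⟩ := exists_cc_hasSum hp f hδ
  obtain ⟨K, hK, hKs, hKle⟩ := exists_cc_hasSum hq g hδ
  have h1 : ∀ n, ccNorm p μ (F n) * ∑' m, ccNorm q μ (K m)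
      ∈ ccSums p q μ (conv μ g (check ((memLp_cc p μ (F n)).toLp (F n)))) := by
    intro n
    rw [← tsum_mul_left]
    refine ccSums_tsum hp hq (fun m => ccSums_single hp (F n) (K m)) (hK.mul_left _) fun x => ?_
    obtain ⟨B, hB⟩ := exists_conv_bilinear (p := p) (q := q) (μ := μ) x
    simp only [coe_ccCoef, hB]
    exact hKs.mapL (B.flip ((memLp_cc p μ (F n)).toLp (F n)))
  refine ⟨_, ccSums_tsum hp hq h1 (hF.mul_right _) fun x => ?_, ?_⟩
  · obtain ⟨B, hB⟩ := exists_conv_bilinear (p := p) (q := q) (μ := μ) x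
    simp only [hB]
    exact hFs.mapL (B g)
  · rw [tsum_mul_right]
    refine le_trans (mul_le_mul hFle hKle ?_ (by positivity)) hδε.le
    exact tsum_nonneg fun m => ccNorm_nonneg _ _ _

theorem exists_ccSums_le [Fact (1 ≤ p)] [Fact (1 ≤ q)] (hp : 0 < p.toReal) (hq : 0 < q.toReal)
    (u : HerzAlgebra p q μ) {ε : ℝ} (hε : 0 < ε) : ∃ r ∈ ccSums p q μ u, r ≤ ‖u‖ + ε := by
  obtain ⟨_, ⟨f, g, h, rfl⟩, hlt⟩ := u.exists_lt (half_pos hε)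
  choose r hr hle using fun i => exists_ccSums_conv hp hq (f i) (g i)
    (ε := ε / 2 / 2 / 2 ^ i) (by positivity)
  have hb := h.summable.hasSum.add (hasSum_geometric_two' (ε / 2))
  have hrs : Summable r := hb.summable.of_nonneg_of_le (fun i => ccSums_nonneg (hr i)) hle
  refine ⟨_, ccSums_tsum hp hq hr hrs h.hasSum, ?_⟩
  have := hrs.tsum_le_tsum hle hb.summable
  rw [hb.tsum_eq] at this
  linarith

/-- Elements of `A_p(G)` are norm convergent sums of coefficients of continuous functions with
compact support, with almost optimal sum of norms. -/
theorem exists_hasSum_ccCoef [Fact (1 ≤ p)] [Fact (1 ≤ q)] (hp : 0 < p.toReal) (hq : 0 < q.toReal)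
    (u : HerzAlgebra p q μ) {ε : ℝ} (hε : 0 < ε) :
    ∃ f g : ℕ → C_c(G, ℂ), Summable (fun i => ccNorm p μ (f i) * ccNorm q μ (g i)) ∧
      HasSum (fun i => ccCoef p q μ (f i) (g i)) u ∧
      ∑' i, ccNorm p μ (f i) * ccNorm q μ (g i) ≤ ‖u‖ + ε := by
  obtain ⟨_, ⟨f, g, hs, h, rfl⟩, hle⟩ := exists_ccSums_le hp hq u hε
  refine ⟨f, g, hs, ?_, hle⟩
  -- Absolute convergence and completeness of `A_p(G)` give a limit in norm; point evaluations
  -- identify it with `u`.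
  have h1 : HasSum (fun i => ccCoef p q μ (f i) (g i)) (∑' i, ccCoef p q μ (f i) (g i)) :=
    (Summable.of_norm_bounded hs fun i => norm_ccCoef_le hp hq _ _).hasSum
  convert h1
  ext x
  exact (h x).unique (h1.mapL (HerzAlgebra.eval x))

end Regular

end

/-! ### Tensor products and multiplication in `A_p(G)` -/

section

section Tensor

variable {X : Type*} [TopologicalSpace X] [R1Space X]

/-- The function `(s, y) ↦ h(s) k(y)`. -/
def tensor (h k : C_c(X, ℂ)) : C_c(X × X, ℂ) :=
  ⟨⟨fun z => h z.1 * k z.2, by fun_prop⟩, HasCompactSupport.intro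
    (h.hasCompactSupport.isCompact.prod k.hasCompactSupport.isCompact) fun z hz => by
      by_contra h0
      have h1 := mul_ne_zero_iff.1 h0
      exact hz ⟨subset_tsupport _ h1.1, subset_tsupport _ h1.2⟩⟩

theorem tensor_apply (h k : C_c(X, ℂ)) (s y : X) : tensor h k (s, y) = h s * k y := rfl

variable [MeasurableSpace X] [BorelSpace X]

theorem ccNorm₂_tensor (r : ℝ≥0∞) (μ : Measure X) (h k : C_c(X, ℂ)) :
    ccNorm₂ r μ (tensor h k) = ccNorm r μ h * ccNorm r μ k := by
  simp only [ccNorm₂, ccNorm, tensor_apply, norm_mul,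
    Real.mul_rpow (norm_nonneg _) (norm_nonneg _), integral_mul_const, integral_const_mul]
  exact Real.mul_rpow (integral_nonneg fun _ => Real.rpow_nonneg (norm_nonneg _) _)
    (integral_nonneg fun _ => Real.rpow_nonneg (norm_nonneg _) _)

end Tensor

variable {G : Type*} [Group G] [TopologicalSpace G] [IsTopologicalGroup G]
  [MeasurableSpace G] [BorelSpace G]

section Product

variable {p q : ℝ≥0∞} [p.HolderConjugate q] {μ : Measure G} [IsFiniteMeasureOnCompacts μ]
  [μ.IsMulLeftInvariant]

/-- A product of two coefficients is the diagonal coefficient of the tensor products of their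
vectors, and `ccNorm₂` is multiplicative on tensors. -/
theorem exists_ccCoef_mul (hp : 0 < p.toReal) (hq : 0 < q.toReal) (f g f' g' : C_c(G, ℂ)) :
    ∃ w : HerzAlgebra p q μ, (∀ x, w x = ccCoef p q μ f g x * ccCoef p q μ f' g' x) ∧
      ‖w‖ ≤ (ccNorm p μ f * ccNorm q μ g) * (ccNorm p μ f' * ccNorm q μ g') := by
  obtain ⟨w, hw, hle⟩ := exists_diagonal_coef (μ := μ) hp hq (tensor g' g) (tensor f' f)
  refine ⟨w, fun x => ?_, ?_⟩
  · rw [hw, ccCoef_apply, ccCoef_apply, ← integral_mul_const]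
    congr 1
    funext y
    rw [← integral_const_mul]
    congr 1
    funext s
    simp only [tensor_apply]
    ring
  · rw [ccNorm₂_tensor, ccNorm₂_tensor] at hle
    linarith

end Product

variable [LocallyCompactSpace G] {p q : ℝ≥0∞} [p.HolderConjugate q] {μ : Measure G} [μ.Regular]
  [μ.IsMulLeftInvariant]

/-- `A_p(G)` is closed under multiplication, and its norm is submultiplicative. -/
theorem exists_mul [Fact (1 ≤ p)] [Fact (1 ≤ q)] (hp : 0 < p.toReal) (hq : 0 < q.toReal)
    (u v : HerzAlgebra p q μ) :
    ∃ w : HerzAlgebra p q μ, (∀ x, w x = u x * v x) ∧ ‖w‖ ≤ ‖u‖ * ‖v‖ := by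
  have key : ∀ ε : ℝ, 0 < ε → ∃ w : HerzAlgebra p q μ, (∀ x, w x = u x * v x) ∧
      ‖w‖ ≤ (‖u‖ + ε) * (‖v‖ + ε) := by
    intro ε hε
    obtain ⟨f, g, hs, hu, hule⟩ := exists_hasSum_ccCoef hp hq u hε
    obtain ⟨f', g', hs', hv, hvle⟩ := exists_hasSum_ccCoef hp hq v hε
    choose z hz hzle using fun k : ℕ × ℕ =>
      exists_ccCoef_mul (μ := μ) hp hq (f k.1) (g k.1) (f' k.2) (g' k.2)
    have hsum := hs.mul_of_nonneg hs' (fun i => ccNorm_mul_nonneg _ _)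
      (fun i => ccNorm_mul_nonneg _ _)
    have hzs : Summable z := Summable.of_norm_bounded hsum hzle
    refine ⟨∑' k, z k, fun x => ?_, ?_⟩
    · have h1 := hzs.hasSum.mapL (HerzAlgebra.eval x)
      simp only [eval_apply, hz] at h1
      have h2 : HasSum (fun i => ccCoef p q μ (f i) (g i) x) (u x) :=
        hu.mapL (HerzAlgebra.eval x)
      have h3 : HasSum (fun i => ccCoef p q μ (f' i) (g' i) x) (v x) :=
        hv.mapL (HerzAlgebra.eval x)
      have h4 := HasSum.mul h2 h3 h1.summable
      exact h1.unique h4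
    · refine (tsum_of_norm_bounded hsum.hasSum hzle).trans ?_
      rw [← hs.tsum_mul_tsum hs' hsum]
      exact mul_le_mul hule hvle (tsum_nonneg fun i => ccNorm_mul_nonneg _ _)
        (add_nonneg (norm_nonneg _) hε.le)
  -- The product is determined by its values, so the bounds for all `ε` concern one and the same
  -- `w`.
  obtain ⟨w, hw, -⟩ := key 1 one_pos
  refine ⟨w, hw, ?_⟩
  have hc : Continuous fun ε : ℝ => (‖u‖ + ε) * (‖v‖ + ε) := by fun_prop
  have h0 := (hc.tendsto 0).mono_left (nhdsWithin_le_nhds (s := Set.Ioi 0))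
  simp only [add_zero] at h0
  refine ge_of_tendsto h0 ?_
  filter_upwards [self_mem_nhdsWithin] with ε hε
  obtain ⟨w', hw', hle⟩ := key ε hε
  have : w = w' := HerzAlgebra.ext fun x => by rw [hw, hw']
  rwa [this]

/-- The inclusion of `A_p(G)` in `B_p(G)`. -/
def toMultiplier [Fact (1 ≤ p)] [Fact (1 ≤ q)] (hp : 0 < p.toReal) (hq : 0 < q.toReal)
    (u : HerzAlgebra p q μ) : MultiplierAlgebra p q μ :=
  ⟨u.toC₀.toBCF, fun v hv => by
    obtain ⟨w, hw, -⟩ := exists_mul hp hq u ⟨v, hv⟩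
    have h : ⇑u.toC₀.toBCF * v = w := funext fun x => by
      rw [hw]
      exact congrArg (· * v x) (u.toC₀_apply x)
    rw [h]
    exact w.2⟩

theorem toMultiplier_apply [Fact (1 ≤ p)] [Fact (1 ≤ q)] (hp : 0 < p.toReal) (hq : 0 < q.toReal)
    (u : HerzAlgebra p q μ) (x : G) : toMultiplier hp hq u x = u x := u.toC₀_apply x

theorem norm_toMultiplier_act_le [Fact (1 ≤ p)] [Fact (1 ≤ q)] (hp : 0 < p.toReal)
    (hq : 0 < q.toReal) (u v : HerzAlgebra p q μ) :
    ‖(toMultiplier hp hq u).act v‖ ≤ ‖u‖ * ‖v‖ := by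
  obtain ⟨w, hw, hle⟩ := exists_mul hp hq u v
  have : (toMultiplier hp hq u).act v = w := HerzAlgebra.ext fun x => by
    rw [hw, MultiplierAlgebra.act_apply, toMultiplier_apply]
  rwa [this]

/-- Submultiplicativity of the `A_p`-norm; this transfers bounds and norm convergence from `A_p(G)`
to `B_p(G)`. -/
theorem norm_toMultiplier_le [Fact (1 ≤ p)] [Fact (1 ≤ q)] (hp : 0 < p.toReal)
    (hq : 0 < q.toReal) (u : HerzAlgebra p q μ) : ‖toMultiplier hp hq u‖ ≤ ‖u‖ := by
  rw [MultiplierAlgebra.norm_eq]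
  exact ContinuousLinearMap.opNorm_le_bound _ (norm_nonneg _) fun v =>
    norm_toMultiplier_act_le hp hq u v

end

/-! ### Twisted tensors and continuity of translation -/

section

section DoubleIntegral

variable {X : Type*} [TopologicalSpace X] [R1Space X] [MeasurableSpace X] [BorelSpace X]

theorem integral_integral_cc_add (μ : Measure X) [IsFiniteMeasureOnCompacts μ]
    (F H : C_c(X × X, ℂ)) : ∫ y, ∫ s, (F + H) (s, y) ∂μ ∂μ
      = ∫ y, ∫ s, F (s, y) ∂μ ∂μ + ∫ y, ∫ s, H (s, y) ∂μ ∂μ := by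
  have h0 : ∀ (F : C_c(X × X, ℂ)) (y s : X), s ∉ Prod.fst '' tsupport F → F (s, y) = 0 := by
    intro F y s hs
    by_contra h
    exact hs ⟨(s, y), subset_tsupport _ h, rfl⟩
  have h1 : ∀ (F : C_c(X × X, ℂ)) (y : X), Integrable (fun s => F (s, y)) μ := fun F y =>
    Continuous.integrable_of_hasCompactSupport (by fun_prop) <|
      HasCompactSupport.intro (F.hasCompactSupport.isCompact.image continuous_fst) (h0 F y)
  have h2 : ∀ F : C_c(X × X, ℂ), Integrable (fun y => ∫ s, F (s, y) ∂μ) μ := by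
    intro F
    refine Continuous.integrable_of_hasCompactSupport ?_ <|
      HasCompactSupport.intro (F.hasCompactSupport.isCompact.image continuous_snd) fun y hy => ?_
    · exact continuous_integral_of_hasCompactSupport μ
        (F.continuous.comp continuous_swap)
        (F.hasCompactSupport.isCompact.image continuous_fst) (h0 F)
    · have h3 : ∀ s, F (s, y) = 0 := fun s => by
        by_contra h
        exact hy ⟨(s, y), subset_tsupport _ h, rfl⟩
      simp [h3]
  rw [← integral_add (h2 F) (h2 H)]
  congr 1
  funext y
  rw [← integral_add (h1 F y) (h1 H y)]
  rfl

end DoubleIntegral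

section Twist

variable {G : Type*} [Group G] [TopologicalSpace G] [IsTopologicalGroup G]

/-- The left translate `y ↦ k(s⁻¹y)`. -/
def translate (s : G) (k : C_c(G, ℂ)) : C_c(G, ℂ) :=
  ⟨⟨fun y => k (s⁻¹ * y), by fun_prop⟩,
    k.hasCompactSupport.comp_homeomorph (Homeomorph.mulLeft s⁻¹)⟩

theorem translate_apply (s : G) (k : C_c(G, ℂ)) (y : G) : translate s k y = k (s⁻¹ * y) := rfl

/-- The function `(s, y) ↦ F(x⁻¹s, x⁻¹y)`. -/
def translate₂ (x : G) (F : C_c(G × G, ℂ)) : C_c(G × G, ℂ) :=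
  ⟨⟨fun z => F (x⁻¹ * z.1, x⁻¹ * z.2), F.continuous.comp (by fun_prop)⟩,
    F.hasCompactSupport.comp_homeomorph
      ((Homeomorph.mulLeft x⁻¹).prodCongr (Homeomorph.mulLeft x⁻¹))⟩

theorem translate₂_apply (x : G) (F : C_c(G × G, ℂ)) (s y : G) :
    translate₂ x F (s, y) = F (x⁻¹ * s, x⁻¹ * y) := rfl

/-- The homeomorphism `(s, y) ↦ (s, s⁻¹y)` of `G × G`. -/
def twistHomeo (G : Type*) [Group G] [TopologicalSpace G] [IsTopologicalGroup G] :
    G × G ≃ₜ G × G where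
  toFun z := (z.1, z.1⁻¹ * z.2)
  invFun z := (z.1, z.1 * z.2)
  left_inv z := by simp
  right_inv z := by simp
  continuous_toFun := by fun_prop
  continuous_invFun := by fun_prop

/-- The function `(s, y) ↦ h(s) k(s⁻¹y)`. -/
def twist (h k : C_c(G, ℂ)) : C_c(G × G, ℂ) :=
  ⟨⟨tensor h k ∘ twistHomeo G, (tensor h k).continuous.comp (twistHomeo G).continuous⟩,
    (tensor h k).hasCompactSupport.comp_homeomorph (twistHomeo G)⟩

theorem twist_apply (h k : C_c(G, ℂ)) (s y : G) : twist h k (s, y) = h s * k (s⁻¹ * y) := rfl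

variable [MeasurableSpace G] [BorelSpace G]

/-- With `y` integrated first, left invariance removes the twist for each fixed `s`. -/
theorem ccNorm₂_twist {r : ℝ≥0∞} (hr : 0 < r.toReal) (μ : Measure G)
    [IsFiniteMeasureOnCompacts μ] [μ.IsMulLeftInvariant] (h k : C_c(G, ℂ)) :
    ccNorm₂ r μ (twist h k) = ccNorm r μ h * ccNorm r μ k := by
  rw [ccNorm₂, integral_norm_rpow_swap hr, ← ccNorm₂_tensor, ccNorm₂, integral_norm_rpow_swap hr]
  congr 2
  funext s
  exact integral_mul_left_eq_self (fun y => ‖tensor h k (s, y)‖ ^ r.toReal) s⁻¹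

/-- On the fibre over `s` the difference is `h(s)` times `k` minus its translate by `s`, so only
translations by points where `h` is nonzero matter. -/
theorem ccNorm₂_tensor_sub_twist_le {r : ℝ≥0∞} (hr : 0 < r.toReal) (μ : Measure G)
    [IsFiniteMeasureOnCompacts μ] (h k : C_c(G, ℂ)) {δ : ℝ} (hδ : 0 ≤ δ)
    (hk : ∀ s, h s ≠ 0 → ccNorm r μ (translate s k - k) ≤ δ) :
    ccNorm₂ r μ (tensor h k - twist h k) ≤ ccNorm r μ h * δ := by
  have h1 : ∀ s, ∫ y, ‖(tensor h k - twist h k) (s, y)‖ ^ r.toReal ∂μ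
      = ‖h s‖ ^ r.toReal * ccNorm r μ (translate s k - k) ^ r.toReal := by
    intro s
    rw [ccNorm_rpow hr, ← integral_const_mul]
    congr 1
    funext y
    rw [← Real.mul_rpow (norm_nonneg _) (norm_nonneg _), ← norm_mul]
    simp only [CompactlySupportedContinuousMap.coe_sub, Pi.sub_apply, tensor_apply, twist_apply,
      translate_apply]
    rw [← mul_sub, norm_mul, norm_mul, norm_sub_rev]
  have h2 : ∫ s, ∫ y, ‖(tensor h k - twist h k) (s, y)‖ ^ r.toReal ∂μ ∂μ
      ≤ (ccNorm r μ h * δ) ^ r.toReal := by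
    rw [Real.mul_rpow (ccNorm_nonneg _ _ _) hδ, ccNorm_rpow hr, ← integral_mul_const]
    refine integral_mono_of_nonneg (Eventually.of_forall fun s => integral_nonneg fun y =>
      Real.rpow_nonneg (norm_nonneg _) _) ?_ (Eventually.of_forall fun s => ?_)
    · refine Integrable.mul_const (Continuous.integrable_of_hasCompactSupport ?_ ?_) _
      · exact h.continuous.norm.rpow_const fun _ => Or.inr hr.le
      · exact h.hasCompactSupport.comp_left (g := fun c : ℂ => ‖c‖ ^ r.toReal)
          (by simp [Real.zero_rpow hr.ne'])
    · simp only [h1]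
      by_cases hs : h s = 0
      · simp [hs, Real.zero_rpow hr.ne']
      · exact mul_le_mul_of_nonneg_left
          (Real.rpow_le_rpow (ccNorm_nonneg _ _ _) (hk s hs) hr.le)
          (Real.rpow_nonneg (norm_nonneg _) _)
  rw [ccNorm₂, integral_norm_rpow_swap hr]
  refine (Real.rpow_le_rpow (integral_nonneg fun s => integral_nonneg fun y =>
    Real.rpow_nonneg (norm_nonneg _) _) h2 (inv_nonneg.2 hr.le)).trans (le_of_eq ?_)
  exact Real.rpow_rpow_inv (mul_nonneg (ccNorm_nonneg _ _ _) hδ) hr.ne'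

/-- Translates become slices of a single function with compact support, `twist h k`, once `h = 1` on
a compact neighbourhood of `e`; continuity of slices then applies. -/
theorem eventually_ccNorm_translate_sub_lt [LocallyCompactSpace G] {r : ℝ≥0∞} (hr : 0 < r.toReal)
    (μ : Measure G) [IsFiniteMeasureOnCompacts μ] (k : C_c(G, ℂ)) {δ : ℝ} (hδ : 0 < δ) :
    ∀ᶠ s in 𝓝 (1 : G), ccNorm r μ (translate s k - k) < δ := by
  obtain ⟨K, hK, hK1⟩ := exists_compact_mem_nhds (1 : G)
  obtain ⟨φ, hφK, -, hφc, -⟩ := exists_continuous_one_zero_of_isCompact hK isClosed_empty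
    (Set.disjoint_empty K)
  let h : C_c(G, ℂ) := ⟨⟨fun s => (φ s : ℂ), by fun_prop⟩,
    hφc.comp_left (g := fun r : ℝ => (r : ℂ)) (by simp)⟩
  have hs : ∀ s ∈ K, slice (twist h k) s = translate s k := by
    intro s hs
    ext y
    have h1 : h s = 1 := by
      change (φ s : ℂ) = 1
      rw [hφK hs]
      simp
    rw [slice_apply, twist_apply, translate_apply, h1, one_mul]
  have h1 : translate 1 k = k := by
    ext y
    simp [translate_apply]
  have hc := (continuous_ccNorm_slice_sub hr μ (twist h k) k).tendsto 1
  rw [hs 1 (mem_of_mem_nhds hK1), h1, sub_self, ccNorm_zero hr] at hc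
  filter_upwards [hc.eventually_lt_const hδ, hK1] with s hs1 hsK
  rwa [hs s hsK] at hs1

variable {p q : ℝ≥0∞} [p.HolderConjugate q] {μ : Measure G} [IsFiniteMeasureOnCompacts μ]
  [μ.IsMulLeftInvariant]

/-- Both terms are diagonal coefficients, of the tensors and of the twists respectively. Writing
`A`, `B` for the tensors, `A'`, `B'` for the twists and `x·` for the diagonal translation, their
difference telescopes as `⟨A - A', x·B⟩ + ⟨A', x·(B - B')⟩`. -/
theorem exists_ccCoef_mul_sub (hp : 0 < p.toReal) (hq : 0 < q.toReal) (f g f' g' : C_c(G, ℂ)) :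
    ∃ z : HerzAlgebra p q μ, (∀ x, z x = ccCoef p q μ f g x * ccCoef p q μ f' g' x
        - ccCoef p q μ f g 1 * ccCoef p q μ f' g' x) ∧
      ‖z‖ ≤ ccNorm₂ q μ (tensor g' g - twist g' g) * ccNorm₂ p μ (tensor f' f)
        + ccNorm₂ q μ (twist g' g) * ccNorm₂ p μ (tensor f' f - twist f' f) := by
  obtain ⟨z₁, hz₁, hle₁⟩ := exists_diagonal_coef (μ := μ) hp hq (tensor g' g - twist g' g)
    (tensor f' f)
  obtain ⟨z₂, hz₂, hle₂⟩ := exists_diagonal_coef (μ := μ) hp hq (twist g' g)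
    (tensor f' f - twist f' f)
  refine ⟨z₁ + z₂, fun x => ?_, (norm_add_le _ _).trans (add_le_add hle₁ hle₂)⟩
  have h1 : ccCoef p q μ f g x * ccCoef p q μ f' g' x
      = ∫ y, ∫ s, (tensor g' g * translate₂ x (tensor f' f)) (s, y) ∂μ ∂μ := by
    rw [ccCoef_apply, ccCoef_apply, ← integral_mul_const]
    congr 1
    funext y
    rw [← integral_const_mul]
    congr 1
    funext s
    simp only [CompactlySupportedContinuousMap.coe_mul, Pi.mul_apply, translate₂_apply,
      tensor_apply]
    ring
  -- Under the diagonal translation by `x` the quantity `s⁻¹y` does not change. The inner integral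
  -- over `y` is therefore the value at `e` of the first coefficient, and only the factor in `s`
  -- still depends on `x`.
  have h2 : ccCoef p q μ f g 1 * ccCoef p q μ f' g' x
      = ∫ y, ∫ s, (twist g' g * translate₂ x (twist f' f)) (s, y) ∂μ ∂μ := by
    rw [← integral_integral_swap_of_hasCompactSupport
      (f := fun s y => (twist g' g * translate₂ x (twist f' f)) (s, y))
      (twist g' g * translate₂ x (twist f' f)).continuous
      (twist g' g * translate₂ x (twist f' f)).hasCompactSupport]
    rw [ccCoef_apply, ccCoef_apply, ← integral_const_mul]
    congr 1
    funext s
    rw [← integral_mul_left_eq_self (fun y => g y * f (1⁻¹ * y)) s⁻¹, ← integral_mul_const]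
    congr 1
    funext y
    simp only [CompactlySupportedContinuousMap.coe_mul, Pi.mul_apply, translate₂_apply,
      twist_apply]
    simp only [inv_one, one_mul, mul_inv_rev, inv_inv, mul_assoc, mul_inv_cancel_left]
    ring
  have h3 := integral_integral_cc_add μ ((tensor g' g - twist g' g) * translate₂ x (tensor f' f))
    (twist g' g * translate₂ x (tensor f' f - twist f' f))
  have h4 := integral_integral_cc_add μ ((tensor g' g - twist g' g) * translate₂ x (tensor f' f)
    + twist g' g * translate₂ x (tensor f' f - twist f' f))
    (twist g' g * translate₂ x (twist f' f))
  have h5 : translate₂ x (tensor f' f - twist f' f)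
    = translate₂ x (tensor f' f) - translate₂ x (twist f' f) := rfl
  have h6 : (tensor g' g - twist g' g) * translate₂ x (tensor f' f)
      + twist g' g * translate₂ x (tensor f' f - twist f' f)
      + twist g' g * translate₂ x (twist f' f) = tensor g' g * translate₂ x (tensor f' f) := by
    rw [h5, sub_mul, mul_sub]
    abel
  rw [h6, h3, ← h1, ← h2] at h4
  rw [HerzAlgebra.coe_add, h4, add_sub_cancel_right, hz₁, hz₂]
  rfl

end Twist

/-! ### Normalized vectors supported near the identity -/

section Bump

variable {G : Type*} [Group G] [TopologicalSpace G] [IsTopologicalGroup G]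
  [LocallyCompactSpace G] [MeasurableSpace G] [BorelSpace G] {p q : ℝ≥0∞} [p.HolderConjugate q]

/-- Normalized coefficients with vectors supported near the identity. -/
theorem exists_bump (hp : 0 < p.toReal) (hq : 0 < q.toReal) (μ : Measure G) [μ.IsHaarMeasure]
    {U : Set G} (hU : U ∈ 𝓝 1) :
    ∃ f g : C_c(G, ℂ), ccNorm p μ f = 1 ∧ ccNorm q μ g = 1 ∧ (∀ s, f s ≠ 0 → s ∈ U) ∧
      (∀ s, g s ≠ 0 → s ∈ U) ∧ ccCoef p q μ f g 1 = 1 := by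
  obtain ⟨φ, hφ1, hφU, hφc, hφ⟩ := exists_continuous_one_zero_of_isCompact
    (isCompact_singleton (x := (1 : G))) (isOpen_interior (s := U)).isClosed_compl
    (Set.disjoint_singleton_left.2 fun h => h (mem_interior_iff_mem_nhds.2 hU))
  have hpos : 0 < ∫ y, φ y ∂μ :=
    φ.continuous.integral_pos_of_hasCompactSupport_nonneg_nonzero (x := 1) hφc
      (fun y => (hφ y).1) (by rw [hφ1 rfl]; exact one_ne_zero)
  set c := ∫ y, φ y ∂μ with hc
  have hψ0 : ∀ y, 0 ≤ φ y / c := fun y => div_nonneg (hφ y).1 hpos.le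
  have hψ : ∫ y, φ y / c ∂μ = 1 := by rw [integral_div, ← hc, div_self hpos.ne']
  -- The vectors are the powers `1/p` and `1/q` of one probability density `φ / c`, so their product
  -- is that density. The default `0` covers `r.toReal = 0`, where the power would be constantly `1`
  -- and lose compact support.
  let k : ℝ≥0∞ → C_c(G, ℂ) := fun r => if hr : 0 < r.toReal then
    ⟨⟨fun y => ((φ y / c) ^ r.toReal⁻¹ : ℝ), Complex.continuous_ofReal.comp
      ((φ.continuous.div_const c).rpow_const fun _ => Or.inr (inv_nonneg.2 hr.le))⟩,
      hφc.comp_left (g := fun t : ℝ => (((t / c) ^ r.toReal⁻¹ : ℝ) : ℂ))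
        (by simp [Real.zero_rpow (inv_ne_zero hr.ne')])⟩ else 0
  have hk : ∀ r : ℝ≥0∞, 0 < r.toReal → ∀ y, k r y = ((φ y / c) ^ r.toReal⁻¹ : ℝ) := by
    intro r hr y
    simp only [k, dif_pos hr]
    rfl
  have hkn : ∀ r : ℝ≥0∞, 0 < r.toReal → ccNorm r μ (k r) = 1 := by
    intro r hr
    have h1 : ∀ y, ‖k r y‖ ^ r.toReal = φ y / c := fun y => by
      rw [hk r hr, Complex.norm_real, Real.norm_of_nonneg (Real.rpow_nonneg (hψ0 y) _),
        Real.rpow_inv_rpow (hψ0 y) hr.ne']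
    rw [ccNorm]
    simp only [h1, hψ, Real.one_rpow]
  have hkU : ∀ r : ℝ≥0∞, 0 < r.toReal → ∀ s, k r s ≠ 0 → s ∈ U := by
    intro r hr s hs
    by_contra hsU
    have h1 : φ s = 0 := hφU fun h => hsU (interior_subset h)
    rw [hk r hr, h1, zero_div, Real.zero_rpow (inv_ne_zero hr.ne')] at hs
    simp at hs
  refine ⟨k p, k q, hkn p hp, hkn q hq, hkU p hp, hkU q hq, ?_⟩
  have hpq : p.toReal⁻¹ + q.toReal⁻¹ = 1 := by
    have := (ENNReal.HolderTriple.toReal (p := p) (q := q) 1 hp hq).inv_add_inv_eq_inv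
    simpa using this
  rw [ccCoef_apply]
  have h1 : ∀ y, k q y * k p (1⁻¹ * y) = ((φ y / c : ℝ) : ℂ) := by
    intro y
    rw [inv_one, one_mul, hk p hp, hk q hq, ← Complex.ofReal_mul,
      ← Real.rpow_add_of_nonneg (hψ0 y) (inv_nonneg.2 hq.le) (inv_nonneg.2 hp.le), add_comm, hpq,
      Real.rpow_one]
  simp only [h1]
  rw [integral_complex_ofReal, hψ, Complex.ofReal_one]

end Bump

end

/-! ### The asymptotically invariant net -/

section

variable {G : Type*} [Group G] [TopologicalSpace G] [IsTopologicalGroup G]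
  [LocallyCompactSpace G] [MeasurableSpace G] [BorelSpace G] {p q : ℝ≥0∞} [p.HolderConjugate q]
  {μ : Measure G} [μ.IsHaarMeasure] [μ.Regular]

/-- An approximate identity at `e` in `A_p(G)`: multiplication by `v i` is asymptotically
multiplication by the value at `e`. -/
theorem exists_invariant_net [Fact (1 ≤ p)] [Fact (1 ≤ q)] (hp : 0 < p.toReal)
    (hq : 0 < q.toReal) (μ : Measure G) [μ.IsHaarMeasure] [μ.Regular] :
    ∃ v : TopologicalSpace.OpenNhdsOf (1 : G) → HerzAlgebra p q μ,
      (∀ U, ‖v U‖ ≤ 1) ∧ (∀ U, v U 1 = 1) ∧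
      ∀ u : HerzAlgebra p q μ,
        Tendsto (fun U => (toMultiplier hp hq (v U)).actL u - u 1 • v U) atBot (𝓝 0) := by
  choose f g hf hg hfU hgU h1 using fun U : TopologicalSpace.OpenNhdsOf (1 : G) =>
    exists_bump (p := p) (q := q) hp hq μ (U.isOpen.mem_nhds U.mem)
  have hv : ∀ U, ‖ccCoef p q μ (f U) (g U)‖ ≤ 1 := fun U => by
    simpa [hf, hg] using norm_ccCoef_le (μ := μ) hp hq (f U) (g U)
  refine ⟨fun U => ccCoef p q μ (f U) (g U), hv, h1, ?_⟩
  -- As operators the defects `T U` are bounded by `2` uniformly in `U`, so it suffices to prove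
  -- convergence to `0` on coefficients, whose finite sums are dense.
  let T : TopologicalSpace.OpenNhdsOf (1 : G) → HerzAlgebra p q μ →L[ℂ] HerzAlgebra p q μ :=
    fun U => (toMultiplier hp hq (ccCoef p q μ (f U) (g U))).actL
      - (HerzAlgebra.eval 1).smulRight (ccCoef p q μ (f U) (g U))
  have hT : ∀ U u, T U u = (toMultiplier hp hq (ccCoef p q μ (f U) (g U))).actL u
      - u 1 • ccCoef p q μ (f U) (g U) := fun U u => rfl
  have hTn : ∀ U u, ‖T U u‖ ≤ 2 * ‖u‖ := by
    intro U u
    rw [hT, two_mul]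
    refine (norm_sub_le _ _).trans (add_le_add ?_ ?_)
    · refine (norm_toMultiplier_act_le hp hq _ u).trans ?_
      exact mul_le_of_le_one_left (norm_nonneg u) (hv U)
    · rw [norm_smul]
      exact (mul_le_of_le_one_right (norm_nonneg _) (hv U)).trans (u.norm_apply_le 1)
  have hcc : ∀ a b : C_c(G, ℂ), Tendsto (fun U => T U (ccCoef p q μ a b)) atBot (𝓝 0) := by
    intro a b
    rw [Metric.tendsto_nhds]
    intro ε hε
    -- The final estimate is `ε / C` times the sum of the two norms; the extra `1` makes `C`
    -- positive and the bound by `ε` strict.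
    set C := ccNorm p μ a + ccNorm q μ b + 1 with hC
    have ha := ccNorm_nonneg p μ a
    have hb := ccNorm_nonneg q μ b
    have hC0 : 0 < C := by positivity
    have hδ : 0 < ε / C := div_pos hε hC0
    -- Translations by points of `V` move `a` and `b` by less than `ε / C`, and the vectors `f U`,
    -- `g U` vanish off `V` as soon as `U ⊆ V`.
    obtain ⟨V, hV, hVo, hV1⟩ := _root_.mem_nhds_iff.1
      ((eventually_ccNorm_translate_sub_lt hp μ a hδ).and
        (eventually_ccNorm_translate_sub_lt hq μ b hδ))
    filter_upwards [eventually_le_atBot (⟨⟨V, hVo⟩, hV1⟩ : TopologicalSpace.OpenNhdsOf (1 : G))]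
      with U hU
    obtain ⟨z, hz, hle⟩ := exists_ccCoef_mul_sub (μ := μ) hp hq a b (f U) (g U)
    have hTz : T U (ccCoef p q μ a b) = z := by
      ext x
      rw [hT, HerzAlgebra.coe_sub, HerzAlgebra.coe_smul, hz, MultiplierAlgebra.actL_apply,
        MultiplierAlgebra.act_apply, toMultiplier_apply, mul_comm]
    have e1 := ccNorm₂_tensor_sub_twist_le hq μ (g U) b hδ.le
      fun s hs => (hV (hU (hgU U s hs))).2.le
    have e2 := ccNorm₂_tensor_sub_twist_le hp μ (f U) a hδ.le
      fun s hs => (hV (hU (hfU U s hs))).1.le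
    rw [ccNorm₂_tensor, ccNorm₂_twist hq] at hle
    rw [hg, one_mul] at e1
    rw [hf, one_mul] at e2
    rw [hf, hg, one_mul, one_mul] at hle
    rw [dist_zero_right, hTz]
    calc ‖z‖ ≤ ε / C * ccNorm p μ a + ccNorm q μ b * (ε / C) :=
          hle.trans (add_le_add (mul_le_mul_of_nonneg_right e1 ha)
            (mul_le_mul_of_nonneg_left e2 hb))
      _ < ε / C * C := by rw [hC]; linarith
      _ = ε := div_mul_cancel₀ ε hC0.ne'
  intro u
  change Tendsto (fun U => T U u) atBot (𝓝 0)
  obtain ⟨a, b, -, hu, -⟩ := exists_hasSum_ccCoef hp hq u one_pos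
  rw [Metric.tendsto_nhds]
  intro ε hε
  obtain ⟨s, hs⟩ := (Metric.tendsto_nhds.1 hu (ε / 4) (by positivity)).exists
  have hfin : Tendsto (fun U => T U (∑ i ∈ s, ccCoef p q μ (a i) (b i))) atBot (𝓝 0) := by
    simp only [map_sum]
    simpa using tendsto_finsetSum s fun i _ => hcc (a i) (b i)
  filter_upwards [Metric.tendsto_nhds.1 hfin (ε / 2) (by positivity)] with U hU
  rw [dist_zero_right] at hU ⊢
  rw [dist_eq_norm, norm_sub_rev] at hs
  have h2 := hTn U (u - ∑ i ∈ s, ccCoef p q μ (a i) (b i))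
  rw [map_sub] at h2
  have h3 := norm_le_norm_sub_add (T U u) (T U (∑ i ∈ s, ccCoef p q μ (a i) (b i)))
  linarith

namespace MultiplierAlgebra

/-- Multiply `u` by an element of the unit ball of `A_p(G)` with value `1` at `e`, and evaluate
there. -/
theorem norm_apply_one_le [Fact (1 ≤ p)] [Fact (1 ≤ q)] (hp : 0 < p.toReal) (hq : 0 < q.toReal)
    (u : MultiplierAlgebra p q μ) : ‖u 1‖ ≤ ‖u‖ := by
  obtain ⟨v, hv, hv1, -⟩ := exists_invariant_net (G := G) (p := p) (q := q) hp hq μ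
  have h := ((u.act (v ⊤)).norm_apply_le 1).trans (u.norm_act_le (v ⊤))
  rw [act_apply, hv1, mul_one] at h
  exact h.trans (mul_le_of_le_one_right (norm_nonneg u) (hv ⊤))

theorem norm_evalOne_le [Fact (1 ≤ p)] [Fact (1 ≤ q)] (hp : 0 < p.toReal) (hq : 0 < q.toReal) :
    ‖evalOne p q μ‖ ≤ 1 :=
  ContinuousLinearMap.opNorm_le_bound _ zero_le_one fun u => by
    rw [one_mul]
    exact u.norm_apply_one_le hp hq

/-- The net of `exists_invariant_net` in `B_p(G)`, where it has the same property with respect to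
all of `B_p(G)`. -/
theorem exists_invariant_net [Fact (1 ≤ p)] [Fact (1 ≤ q)] (hp : 0 < p.toReal)
    (hq : 0 < q.toReal) (μ : Measure G) [μ.IsHaarMeasure] [μ.Regular] :
    ∃ v : TopologicalSpace.OpenNhdsOf (1 : G) → MultiplierAlgebra p q μ,
      (∀ U, ‖v U‖ ≤ 1) ∧ (∀ U, v U 1 = 1) ∧
      ∀ u : MultiplierAlgebra p q μ,
        Tendsto (fun U => u * v U - u 1 • v U) atBot (𝓝 0) := by
  obtain ⟨v, hv, hv1, hvt⟩ := Herz.exists_invariant_net (G := G) (p := p) (q := q) hp hq μ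
  refine ⟨fun U => toMultiplier hp hq (v U), fun U => (norm_toMultiplier_le hp hq _).trans (hv U),
    fun U => by rw [toMultiplier_apply, hv1], fun u => ?_⟩
  -- Only `w(e) = 1` matters. It gives `u v - u(e) v = ((uw) v - (uw)(e) v) - u (w v - w(e) v)` for
  -- `v = v U`, where `w` and `uw` both lie in `A_p(G)`, so the convergence already proved there
  -- applies to each term.
  set w := v ⊤ with hw
  have h1 := (hvt w).norm.const_mul ‖u‖
  have h2 := (hvt (u.act w)).norm
  have h3 := h1.add h2
  simp only [norm_zero, mul_zero, add_zero] at h3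
  rw [tendsto_zero_iff_norm_tendsto_zero]
  refine squeeze_zero (fun _ => norm_nonneg _) (fun U => ?_) h3
  have key : u * toMultiplier hp hq (v U) - u 1 • toMultiplier hp hq (v U)
      = toMultiplier hp hq ((toMultiplier hp hq (v U)).actL (u.act w) - (u.act w) 1 • v U)
        - u * toMultiplier hp hq ((toMultiplier hp hq (v U)).actL w - w 1 • v U) := by
    ext x
    have hsub : ∀ a b : MultiplierAlgebra p q μ, (a - b) x = a x - b x := fun _ _ => rfl
    simp only [hsub, coe_mul, coe_smul, toMultiplier_apply, HerzAlgebra.coe_sub,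
      HerzAlgebra.coe_smul, actL_apply, act_apply, hw, hv1]
    ring
  rw [key, add_comm]
  refine (norm_sub_le _ _).trans (add_le_add (norm_toMultiplier_le hp hq _) ?_)
  exact (norm_mul_le _ _).trans
    (mul_le_mul_of_nonneg_left (norm_toMultiplier_le hp hq _) (norm_nonneg u))

end MultiplierAlgebra

end

end Herz

end
-- The invariant mean as a weak* limit
theorem theorem3p1 {G : Type*} [Group G] [TopologicalSpace G] [IsTopologicalGroup G]
    [T2Space G] [LocallyCompactSpace G] [MeasurableSpace G] [BorelSpace G]
    (μ : Measure G) [μ.IsHaarMeasure] [μ.Regular]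
    (p q : ℝ≥0∞) (hp : 1 < p) (hp' : p < ∞) [p.HolderConjugate q] :
    ∃ F ∈ Herz.MultiplierAlgebra.means p q μ,
      ∀ u : Herz.MultiplierAlgebra p q μ, Herz.MultiplierAlgebra.bidualAct u F = u 1 • F := by
  have hq1 : 1 ≤ q := ENNReal.HolderConjugate.one_le q p
  have : Fact (1 ≤ p) := ⟨hp.le⟩
  have : Fact (1 ≤ q) := ⟨hq1⟩
  have hp0 : 0 < p.toReal := ENNReal.toReal_pos (zero_lt_one.trans hp).ne' hp'.ne
  have hq0 : 0 < q.toReal := by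
    -- If `q = ∞`, then `1/p + 1/q = 1` would force `p = 1`.
    refine ENNReal.toReal_pos (zero_lt_one.trans_le hq1).ne' fun h => hp.ne' ?_
    have := ENNReal.HolderConjugate.inv_add_inv_eq_one p q
    simpa [h] using this
  obtain ⟨v, hv, hv1, hvt⟩ :=
    Herz.MultiplierAlgebra.exists_invariant_net (G := G) (p := p) (q := q) hp0 hq0 μ
  let J := NormedSpace.inclusionInDoubleDual ℂ (Herz.MultiplierAlgebra p q μ)
  have hJ : ∀ U, ‖J (v U)‖ ≤ 1 := fun U =>
    (NormedSpace.double_dual_bound ℂ _ (v U)).trans (hv U)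
  -- An ultrafilter finer than shrinking neighbourhoods: by Banach–Alaoglu the net converges weak*
  -- along it, and limits along `atBot` persist.
  let 𝒰 : Ultrafilter (TopologicalSpace.OpenNhdsOf (1 : G)) := Ultrafilter.of atBot
  obtain ⟨F, hF, hlim⟩ := (WeakDual.isCompact_closedBall (𝕜 := ℂ)
    (0 : StrongDual ℂ (StrongDual ℂ (Herz.MultiplierAlgebra p q μ))) 1).ultrafilter_le_nhds
    (𝒰.map fun U => StrongDual.toWeakDual (J (v U))) <| by
      rw [le_principal_iff, Ultrafilter.mem_coe, Ultrafilter.mem_map]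
      exact univ_mem' fun U => by simpa using hJ U
  have hFt : ∀ φ : StrongDual ℂ (Herz.MultiplierAlgebra p q μ),
      Tendsto (fun U => φ (v U)) 𝒰 (𝓝 (WeakDual.toStrongDual F φ)) := fun φ =>
    ((WeakDual.eval_continuous φ).tendsto F).comp hlim
  have hFI : WeakDual.toStrongDual F (Herz.MultiplierAlgebra.evalOne p q μ) = 1 := by
    refine tendsto_nhds_unique (hFt _) ?_
    have h1 : ∀ U, Herz.MultiplierAlgebra.evalOne p q μ (v U) = 1 := hv1
    simp only [h1]
    exact tendsto_const_nhds
  have hFn : ‖WeakDual.toStrongDual F‖ ≤ 1 := by simpa using hF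
  refine ⟨WeakDual.toStrongDual F, ⟨le_antisymm hFn ?_, hFI⟩, fun u => ?_⟩
  -- The lower bound on the norm: `1 = ‖F(I)‖ ≤ ‖F‖ ‖I‖ ≤ ‖F‖`.
  · have h1 := (WeakDual.toStrongDual F).le_opNorm (Herz.MultiplierAlgebra.evalOne p q μ)
    rw [hFI, norm_one] at h1
    exact h1.trans (mul_le_of_le_one_right (norm_nonneg _)
      (Herz.MultiplierAlgebra.norm_evalOne_le hp0 hq0))
  · ext φ
    rw [Herz.MultiplierAlgebra.bidualAct_apply, smul_apply, smul_eq_mul]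
    have h1 := (hFt (Herz.MultiplierAlgebra.dualAct φ u)).sub ((hFt φ).const_mul (u 1))
    have h2 : Tendsto (fun U => φ (u * v U - u 1 • v U)) 𝒰 (𝓝 (φ 0)) :=
      (φ.continuous.tendsto 0).comp ((hvt u).mono_left (Ultrafilter.of_le atBot))
    simp only [map_sub, map_smul, smul_eq_mul, map_zero] at h2
    exact sub_eq_zero.1 (tendsto_nhds_unique h1 h2)
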